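/- All tournaments are finite. For an ordering $\theta$ of the vertices of a tournament $H$, an arc $(x,y)$ of $H$ is *backward* if $y$ precedes $x$ in $\theta$. A set of vertices is *consecutive* under $\theta$ if it is an interval of $\theta$. We say that $V(H)$ is the *disjoint union of $X_1,\dots,X_k$ under $\theta$* if $V(H)$ is the disjoint union of the sets $X_i$ and every backward arc of $H$ has both ends in one and the same $X_i$. $H|X$ is the subtournament induced by $X$, and $\theta_X$ the restriction of $\theta$ to $X$. **Stars and path-galaxies.** A *right star* (resp. *left star*) of $H$ under $\theta$ with center $c$ and non-empty leaf set $L$ is a subtournament $H|(\{c\}\cup L)$ such that every leaf precedes $c$ and its backward arcs are exactly the arcs $(c,x)$, $x\in L$ (resp. every leaf follows $c$ and its backward arcs are exactly the arcs $(x,c)$, $x\in L$). $H$ is a *path-galaxy* under $\theta$ if $V(H)$ is the disjoint union under $\theta$ of the vertex sets of left or right stars $Q_1,\dots,Q_m$ ($m\ge 0$) of $H$ under $\theta$ and of a set of vertices incident to no backward arc, where no center of a star lies between two leaves of another star, and the leaves of every star are consecutive under $\theta$. **Pair-stars.** A tournament with vertices ordered as $(1,\dots,t)$ is * a *middle-pair-star*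 if, for some $r$ with $2\le r\le t-5$, its set of backward arcs is either $\{(r+3,r),(r+4,r+1)\}\cup\{(r,i):1\le i\le r-1\}\cup\{(i,r+4):r+5\le i\le t\}$ or $\{(r+3,r),(r+4,r+1)\}\cup\{(r+4,i):1\le i\le r-1\}\cup\{(i,r):r+5\le i\le t\}$; its golden vertices are $r,\dots,r+4$; * a *left-pair-star* if, for some $j$ with $6\le j\le t-1$, its set of backward arcs is either $\{(4,1),(5,2)\}\cup\{(i,5):6\le i\le j\}\cup\{(i,1):j+1\le i\le t\}$ or $\{(4,1),(5,2)\}\cup\{(i,1):6\le i\le j\}\cup\{(i,5):j+1\le i\le t\}$; its golden vertices are $1,\dots,5$; * a *right-pair-star* if, for some $j$ with $1\le j\le t-6$, its set of backward arcs is either $\{(t-1,t-4),(t,t-3)\}\cup\{(t-4,i):1\le i\le j\}\cup\{(t,i):j+1\le i\le t-5\}$ or $\{(t-1,t-4),(t,t-3)\}\cup\{(t,i):1\le i\le j\}\cup\{(t-4,i):j+1\le i\le t-5\}$; its golden vertices are $t-4,\dots,t$. The *centers* are the first and the last golden vertex, and the *leaves* are the non-golden vertices. A *pair-star of $H$ under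 $\theta$* is an induced subtournament of $H$ which, with its vertices ordered by $\theta$, is a middle-, left- or right-pair-star, whose golden vertices are consecutive under $\theta$, and for which, for each of the two centers, the leaves joined to that center by a backward arc are consecutive under $\theta$. **Spiral galaxies.** $H$ is a *spiral galaxy* if there is an ordering $\theta$ of its vertices such that $V(H)$ is the disjoint union of $V(S_1),\dots,V(S_l),X$ under $\theta$ ($l\ge 0$), where $S_1,\dots,S_l$ are pair-stars of $H$ under $\theta$; every vertex of $S_i$ precedes every vertex of $S_j$ under $\theta$ whenever $i<j$; and $H|X$ is a path-galaxy under $\theta_X$, the leaves of each of whose stars are consecutive also under $\theta$. **Theorem.** Every spiral galaxy $H$ has the strong Erdős–Hajnal property: there exists $\alpha>0$ such that every tournament $T$ with $|T|>1$ that has no induced subtournament isomorphic to $H$ contains disjoint vertex sets $A$, $B$ with $|A|\ge\alpha|T|$ and $|B|\ge\alpha|T|$ such that every vertex of $A$ is adjacent to every vertex of $B$. -/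

import Mathlib

universe u v

/-- A tournament with vertex set `V`: an orientation of the complete graph on `V`.
`Adj x y` says that the arc between `x` and `y` is `(x, y)` ("`x` is adjacent to `y`"). -/
structure Tournament (V : Type u) where
  Adj : V → V → Prop
  asymm : ∀ x y, Adj x y → ¬ Adj y x
  total : ∀ x y, x ≠ y → Adj x y ∨ Adj y x

namespace Tournament

/-- The subtournament `H | X` induced by `X`. -/
def induce {V : Type u} (H : Tournament V) (X : Set V) : Tournament X where
  Adj x y := H.Adj x y
  asymm x y := H.asymm x y
  total x y h := H.total x y (fun e => h (Subtype.ext e))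

/-- `T` contains `H`: some induced subtournament of `T` is isomorphic to `H`. -/
def Contains {W : Type v} {V : Type u} (T : Tournament W) (H : Tournament V) : Prop :=
  ∃ X : Set W, Nonempty (H.Adj ≃r (T.induce X).Adj)

/-- `(A, B)` is a pure pair of `T`: `A`, `B` are disjoint and all arcs between them go from `A`
to `B`. -/
def IsPurePair {W : Type v} (T : Tournament W) (A B : Finset W) : Prop :=
  Disjoint A B ∧ ∀ a ∈ A, ∀ b ∈ B, T.Adj a b

/-- The strong Erdős–Hajnal property of `H`: for some `α > 0`, every finite `H`-free tournament
`T` with more than one vertex has a pure pair both of whose sides have at least `α |T|`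
vertices. -/
def HasStrongEHProperty {V : Type u} (H : Tournament V) : Prop :=
  ∃ α : ℝ, 0 < α ∧ ∀ (W : Type v) [Fintype W] (T : Tournament W),
    ¬ T.Contains H → 1 < Fintype.card W →
      ∃ A B : Finset W, T.IsPurePair A B ∧
        α * (Fintype.card W : ℝ) ≤ (A.card : ℝ) ∧ α * (Fintype.card W : ℝ) ≤ (B.card : ℝ)

/-! An ordering of the vertex set is a linear order on `V`. Its restriction to `X ⊆ V` is the
order of the subtype, and a set of vertices is consecutive under the ordering when it is
order-connected (`Set.OrdConnected`). -/

section Ordering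

variable {V : Type u} [LinearOrder V]

/-- `(x, y)` is a backward arc of `H` under the ordering. -/
def IsBackwardArc (H : Tournament V) (x y : V) : Prop :=
  H.Adj x y ∧ y < x

/-- `{c} ∪ L` is a right star of `H` under the ordering, with center `c` and leaf set `L`. -/
def IsRightStar (H : Tournament V) (c : V) (L : Set V) : Prop :=
  L.Nonempty ∧ (∀ x ∈ L, x < c) ∧
    ∀ x ∈ insert c L, ∀ y ∈ insert c L, H.IsBackwardArc x y ↔ x = c ∧ y ∈ L

/-- `{c} ∪ L` is a left star of `H` under the ordering, with center `c` and leaf set `L`. -/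
def IsLeftStar (H : Tournament V) (c : V) (L : Set V) : Prop :=
  L.Nonempty ∧ (∀ x ∈ L, c < x) ∧
    ∀ x ∈ insert c L, ∀ y ∈ insert c L, H.IsBackwardArc x y ↔ x ∈ L ∧ y = c

/-- The ordering is a galaxy ordering of `H`, the stars being `{c i} ∪ L i` for `i < m`: they are
frontier stars, they are pairwise disjoint, every backward arc lies inside one of them (so that
every remaining vertex is a singleton component of the backward arc digraph), and no center of a
star is between leaves of another star. -/
structure IsGalaxyWith (H : Tournament V) {m : ℕ} (c : Fin m → V) (L : Fin m → Set V) :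
    Prop where
  star : ∀ i, H.IsRightStar (c i) (L i) ∨ H.IsLeftStar (c i) (L i)
  disjoint : ∀ i j, i ≠ j → Disjoint (insert (c i) (L i)) (insert (c j) (L j))
  backward : ∀ x y, H.IsBackwardArc x y →
    ∃ i, x ∈ insert (c i) (L i) ∧ y ∈ insert (c i) (L i)
  center : ∀ i j, i ≠ j → ∀ x ∈ L j, ∀ y ∈ L j, ¬ (x < c i ∧ c i < y)

/-- `H` is a path-galaxy under the ordering, with the stars `{c i} ∪ L i`: it is a galaxy, and the
leaves of every star are consecutive. -/
def IsPathGalaxyWith (H : Tournament V) {m : ℕ} (c : Fin m → V) (L : Fin m → Set V) : Prop :=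
  H.IsGalaxyWith c L ∧ ∀ i, (L i).OrdConnected

end Ordering

/-- `A` is the set of backward arcs of a middle-pair-star under the ordering `(1, …, t)` of its
vertices, with golden vertices `r, …, r + 4`. -/
def IsMiddlePairStarArcs (t r : ℕ) (A : Set (ℕ × ℕ)) : Prop :=
  2 ≤ r ∧ r + 5 ≤ t ∧
    (A = {(r + 3, r), (r + 4, r + 1)} ∪ (fun i => (r, i)) '' Set.Ico 1 r
        ∪ (fun i => (i, r + 4)) '' Set.Icc (r + 5) t ∨
      A = {(r + 3, r), (r + 4, r + 1)} ∪ (fun i => (r + 4, i)) '' Set.Ico 1 r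
        ∪ (fun i => (i, r)) '' Set.Icc (r + 5) t)

/-- `A` is the set of backward arcs of a left-pair-star under the ordering `(1, …, t)` of its
vertices; the golden vertices are `1, …, 5`. -/
def IsLeftPairStarArcs (t : ℕ) (A : Set (ℕ × ℕ)) : Prop :=
  ∃ j, 6 ≤ j ∧ j + 1 ≤ t ∧
    (A = {(4, 1), (5, 2)} ∪ (fun i => (i, 5)) '' Set.Icc 6 j
        ∪ (fun i => (i, 1)) '' Set.Icc (j + 1) t ∨
      A = {(4, 1), (5, 2)} ∪ (fun i => (i, 1)) '' Set.Icc 6 j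
        ∪ (fun i => (i, 5)) '' Set.Icc (j + 1) t)

/-- `A` is the set of backward arcs of a right-pair-star under the ordering `(1, …, t)` of its
vertices, the mirror image of a left-pair-star; the golden vertices are `t - 4, …, t`. -/
def IsRightPairStarArcs (t : ℕ) (A : Set (ℕ × ℕ)) : Prop :=
  ∃ j, 1 ≤ j ∧ j + 6 ≤ t ∧
    (A = {(t - 1, t - 4), (t, t - 3)} ∪ (fun i => (t - 4, i)) '' Set.Icc 1 j
        ∪ (fun i => (t, i)) '' Set.Icc (j + 1) (t - 5) ∨
      A = {(t - 1, t - 4), (t, t - 3)} ∪ (fun i => (t, i)) '' Set.Icc 1 j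
        ∪ (fun i => (t - 4, i)) '' Set.Icc (j + 1) (t - 5))

/-- `A` is the set of backward arcs of a pair-star under the ordering `(1, …, t)`, with golden
vertices `a, …, a + 4`; its centers are `a` and `a + 4`, its leaves the non-golden vertices. -/
def IsPairStarArcs (t a : ℕ) (A : Set (ℕ × ℕ)) : Prop :=
  IsMiddlePairStarArcs t a A ∨ (a = 1 ∧ IsLeftPairStarArcs t A) ∨
    (a + 4 = t ∧ IsRightPairStarArcs t A)

section Ordering

variable {V : Type u} [LinearOrder V]

/-- `S` is (the vertex set of) a pair-star of `H` under the ordering. Here `w` lists `S` in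
increasing order, `w k` being the vertex number `k + 1`; the golden vertices are consecutive, and
for each of the two centers the leaves incident to it in the backward arc digraph are
consecutive, both with respect to the whole ordering of `H`. -/
def IsPairStar (H : Tournament V) (S : Set V) : Prop :=
  ∃ (t a : ℕ) (A : Set (ℕ × ℕ)) (w : Fin t → V),
    StrictMono w ∧ Set.range w = S ∧ IsPairStarArcs t a A ∧
    (∀ i k : Fin t, H.IsBackwardArc (w i) (w k) ↔ ((i : ℕ) + 1, (k : ℕ) + 1) ∈ A) ∧
    (w '' {k | (k : ℕ) + 1 ∈ Set.Icc a (a + 4)}).OrdConnected ∧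
    ∀ p ∈ ({a, a + 4} : Set ℕ),
      (w '' {k | (k : ℕ) + 1 ∉ Set.Icc a (a + 4) ∧
        (((k : ℕ) + 1, p) ∈ A ∨ (p, (k : ℕ) + 1) ∈ A)}).OrdConnected

/-- The ordering is a spiral galaxy ordering of `H`: the vertex set is the disjoint union, under
the ordering, of pair-stars `S 0, …, S (l - 1)`, each of which precedes the next one, and of a set
`X` such that `H | X` is a path-galaxy under the restricted ordering, the leaves of whose stars
are consecutive under the whole ordering as well. -/
def IsSpiralGalaxyOrdering (H : Tournament V) : Prop :=
  ∃ (l : ℕ) (S : Fin l → Set V) (X : Set V),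
    (∀ i, H.IsPairStar (S i)) ∧
    (∀ i j, i ≠ j → Disjoint (S i) (S j)) ∧
    (∀ i, Disjoint (S i) X) ∧
    (⋃ i, S i) ∪ X = Set.univ ∧
    (∀ x y, H.IsBackwardArc x y → (∃ i, x ∈ S i ∧ y ∈ S i) ∨ (x ∈ X ∧ y ∈ X)) ∧
    (∃ (m : ℕ) (c : Fin m → X) (L : Fin m → Set X), (H.induce X).IsPathGalaxyWith c L ∧
      ∀ i, (Subtype.val '' L i : Set V).OrdConnected) ∧
    ∀ i j, i < j → ∀ x ∈ S i, ∀ y ∈ S j, x < y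

end Ordering

/-- `H` is a spiral galaxy: some ordering of its vertices is a spiral galaxy ordering. -/
def IsSpiralGalaxy {V : Type u} (H : Tournament V) : Prop :=
  ∃ _ : LinearOrder V, H.IsSpiralGalaxyOrdering

end Tournament

-- Let `T` be `H`-free without a pure pair of linear size. When a greedy embedding of `H` gets
-- stuck, it exposes two linear-sized sets with almost all arcs from one to the other. Iterating
-- gives many disjoint linear-sized blocks in which each vertex is joined forward to almost all of
-- every other block (`exists_sparseBlocks`). Hence it suffices to cut `H` into pieces that use
-- different blocks and are joined forward to each other, provided each piece still embeds after
-- half of every block is deleted (`exists_isHom_of_pieces`).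
--
-- Backward arcs come from the lack of pure pairs: some vertex of a block has many backward
-- neighbours in each of several prescribed blocks, and these contain large transitive tournaments
-- (`NoPurePair.exists_broom`). What remains uncontrolled is the direction of the arcs between
-- backward neighbours lying in different blocks.
--
-- A backward triangle consists of vertices in three blocks with all three arcs backward. After
-- shrinking the blocks, either there is none, or one triple of blocks per vertex of `H` contains
-- such a triangle robustly (`exists_triangleFree_or_robust_blocks`).
--
-- If there is none, backward neighbours of a common vertex in different blocks are joined forward.
-- The pieces are then the components of the backward arcs of `H`, all of which are stars: the first
-- golden vertex with the fourth and its leaves, the last with the second and its leaves, the middle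
-- one alone, and the stars of the path-galaxy.
--
-- If there are robust triangles, the golden vertices `1, ..., 5` of each pair-star, being
-- consecutive, can be reordered as `4, 1, 3, 5, 2`. The arcs `(4, 1)` and `(5, 2)` become forward,
-- and the backward arcs among golden vertices are now exactly `(3, 4)`, `(2, 4)`, `(2, 3)`: a
-- backward triangle in positions one, three and five. Every other piece is a center with its own
-- leaves; these are consecutive, so they fit into one block and no control across blocks is needed.

universe w

namespace Tournament

/-! ### Greedy embedding, sparse pairs and sparse blocks -/

section Blocks

open scoped Classical

variable {V : Type u} {W : Type v}

theorem irrefl (T : Tournament W) (x : W) : ¬ T.Adj x x := fun h => T.asymm x x h h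

theorem adj_of_not_adj (T : Tournament W) {x y : W} (hne : x ≠ y) (h : ¬ T.Adj x y) : T.Adj y x :=
  (T.total x y hne).resolve_left h

/-- An arc-preserving map from `H` to `T`; it is automatically an embedding. -/
def IsHom (H : Tournament V) (T : Tournament W) (φ : V → W) : Prop :=
  ∀ u v, H.Adj u v → T.Adj (φ u) (φ v)

theorem contains_of_isHom {H : Tournament V} {T : Tournament W} {φ : V → W}
    (h : IsHom H T φ) : T.Contains H := by
  have hinj : Function.Injective φ := by
    intro u v huv
    by_contra hne
    rcases H.total u v hne with h1 | h1
    · have := h _ _ h1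
      rw [huv] at this
      exact T.irrefl _ this
    · have := h _ _ h1
      rw [huv] at this
      exact T.irrefl _ this
  refine ⟨Set.range φ, ⟨⟨Equiv.ofInjective φ hinj, ?_⟩⟩⟩
  intro u v
  change T.Adj (φ u) (φ v) ↔ H.Adj u v
  refine ⟨fun h1 => ?_, h u v⟩
  by_contra h2
  by_cases hne : u = v
  · subst hne
    exact T.irrefl _ h1
  · exact T.asymm _ _ h1 (h _ _ (H.adj_of_not_adj hne h2))

/-- Among the vertices other than `x`, either the out-neighbours or the in-neighbours of `x` number
at least `2 ^ n`; accordingly `x` is put first or last. -/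
theorem exists_transitive_fin (T : Tournament W) : ∀ (n : ℕ) (M : Finset W), 2 ^ n ≤ M.card →
    ∃ f : Fin n → W, (∀ i, f i ∈ M) ∧ ∀ i j, i < j → T.Adj (f i) (f j)
  | 0, _, _ => ⟨Fin.elim0, fun i => i.elim0, fun i => i.elim0⟩
  | n + 1, M, hM => by
    have hpos : 0 < M.card := lt_of_lt_of_le (by positivity) hM
    obtain ⟨x, hx⟩ := Finset.card_pos.mp hpos
    have hsplit := Finset.card_filter_add_card_filter_not (s := M.erase x) (fun y => T.Adj x y)
    rw [Finset.card_erase_of_mem hx] at hsplit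
    rw [pow_succ] at hM
    rcases le_or_gt (2 ^ n) ((M.erase x).filter (fun y => T.Adj x y)).card with h | h
    · obtain ⟨f, hf, hadj⟩ := exists_transitive_fin T n _ h
      refine ⟨Fin.cons x f, ?_, ?_⟩
      · intro i
        refine Fin.cases hx (fun i => ?_) i
        exact Finset.mem_of_mem_erase (Finset.mem_filter.mp (hf i)).1
      · intro i j
        refine Fin.cases ?_ (fun j => ?_) j
        · intro h; exact absurd h (Fin.not_lt_zero _)
        · refine Fin.cases ?_ (fun i => ?_) i
          · intro _
            exact (Finset.mem_filter.mp (hf j)).2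
          · intro h
            exact hadj i j (Fin.succ_lt_succ_iff.mp h)
    · have h' : 2 ^ n ≤ ((M.erase x).filter (fun y => ¬ T.Adj x y)).card := by omega
      obtain ⟨f, hf, hadj⟩ := exists_transitive_fin T n _ h'
      refine ⟨Fin.snoc f x, ?_, ?_⟩
      · intro i
        refine Fin.lastCases ?_ (fun i => ?_) i
        · simpa using hx
        · simpa using Finset.mem_of_mem_erase (Finset.mem_filter.mp (hf i)).1
      · intro i j
        refine Fin.lastCases ?_ (fun j => ?_) j
        · refine Fin.lastCases ?_ (fun i => ?_) i
          · intro h; exact absurd h (lt_irrefl _)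
          · intro _
            have := Finset.mem_filter.mp (hf i)
            simpa using T.adj_of_not_adj (Finset.ne_of_mem_erase this.1).symm this.2
        · refine Fin.lastCases ?_ (fun i => ?_) i
          · intro h
            exact absurd h (not_lt.mpr (Fin.le_last _))
          · intro h
            simpa using hadj i j (by simpa using h)

theorem exists_transitive [Fintype V] [LinearOrder V] (T : Tournament W) (M : Finset W)
    (hM : 2 ^ Fintype.card V ≤ M.card) :
    ∃ f : V → W, (∀ i, f i ∈ M) ∧ ∀ i j, i < j → T.Adj (f i) (f j) := by
  obtain ⟨f, hf, hadj⟩ := T.exists_transitive_fin _ M hM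
  let e := (Fintype.orderIsoFinOfCardEq V rfl).symm
  exact ⟨fun v => f (e v), fun v => hf _, fun i j h => hadj _ _ (e.lt_iff_lt.mpr h)⟩

theorem exists_disjoint_subsets (U : Finset W) (q : ℕ) (S : Finset V) (h : S.card * q ≤ U.card) :
    ∃ P : V → Finset W, (∀ v ∈ S, P v ⊆ U ∧ (P v).card = q) ∧
      ∀ u ∈ S, ∀ v ∈ S, u ≠ v → Disjoint (P u) (P v) := by
  induction S using Finset.induction_on generalizing U with
  | empty => exact ⟨fun _ => ∅, by simp, by simp⟩
  | insert a S ha ih =>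
    rw [Finset.card_insert_of_notMem ha, add_mul, one_mul] at h
    obtain ⟨A, hA, hAc⟩ := Finset.exists_subset_card_eq (show q ≤ U.card by omega)
    obtain ⟨P, hP, hd⟩ := ih (U \ A) (by rw [Finset.card_sdiff_of_subset hA]; omega)
    have hav : ∀ v ∈ S, v ≠ a := fun v hv e => ha (e ▸ hv)
    have hdA : ∀ v ∈ S, Disjoint A (P v) := fun v hv =>
      Finset.disjoint_of_subset_right (hP v hv).1 Finset.disjoint_sdiff
    refine ⟨Function.update P a A, ?_, ?_⟩
    · intro v hv
      rcases Finset.mem_insert.mp hv with rfl | hv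
      · simp [hA, hAc]
      · rw [Function.update_of_ne (hav v hv)]
        exact ⟨(hP v hv).1.trans Finset.sdiff_subset, (hP v hv).2⟩
    · intro u hu v hv huv
      rw [Finset.mem_insert] at hu hv
      rcases hu with hu | hu <;> rcases hv with hv | hv
      · exact absurd (hu.trans hv.symm) huv
      · rw [hu, Function.update_self, Function.update_of_ne (hav v hv)]
        exact hdA v hv
      · rw [hv, Function.update_self, Function.update_of_ne (hav u hu)]
        exact (hdA u hu).symm
      · rw [Function.update_of_ne (hav v hv), Function.update_of_ne (hav u hu)]
        exact hd u hu v hv huv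

/-- Vertices of `H` are embedded one by one, keeping for each remaining vertex a candidate set that
loses at most a factor `lam` per step. If no choice for `a` preserves all candidate sets, many
choices fail at the same `w`, and failing means being sparse to `U w`. -/
theorem exists_isHom_or_sparse_pair [Fintype V] [Nonempty W] (H : Tournament V)
    (T : Tournament W) {lam m : ℝ}
    (h0 : 0 < lam) (h1 : lam ≤ 1) (hm : 0 < m) (X : Finset W) (S : Finset V) (U : V → Finset W)
    (hX : ∀ v ∈ S, U v ⊆ X) (hd : ∀ u ∈ S, ∀ v ∈ S, u ≠ v → Disjoint (U u) (U v))
    (hc : ∀ v ∈ S, m ≤ lam ^ S.card * (U v).card) :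
    (∃ φ : V → W, (∀ v ∈ S, φ v ∈ U v) ∧ ∀ u ∈ S, ∀ v ∈ S, H.Adj u v → T.Adj (φ u) (φ v)) ∨
    ∃ A B : Finset W, A ⊆ X ∧ B ⊆ X ∧ Disjoint A B ∧ m ≤ Fintype.card V * A.card ∧ m ≤ B.card ∧
      ((∀ x ∈ A, ((B.filter (fun y => T.Adj x y)).card : ℝ) ≤ lam * B.card) ∨
        (∀ x ∈ A, ((B.filter (fun y => T.Adj y x)).card : ℝ) ≤ lam * B.card)) := by
  induction S using Finset.induction_on generalizing U with
  | empty => exact Or.inl ⟨fun _ => Classical.arbitrary W, by simp, by simp⟩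
  | insert a S ha ih =>
    have hav : ∀ v ∈ S, v ≠ a := fun v hv e => ha (e ▸ hv)
    have haS : a ∈ insert a S := Finset.mem_insert_self a S
    have hS : ∀ v ∈ S, v ∈ insert a S := fun v hv => Finset.mem_insert_of_mem hv
    have hbig : ∀ v ∈ insert a S, m ≤ (U v).card := fun v hv =>
      (hc v hv).trans (mul_le_of_le_one_left (Nat.cast_nonneg _) (pow_le_one₀ h0.le h1))
    let N : V → W → Finset W := fun w x =>
      (U w).filter (fun y => (H.Adj a w → T.Adj x y) ∧ (H.Adj w a → T.Adj y x))
    by_cases hgood : ∃ x ∈ U a, ∀ w ∈ S, lam * (U w).card ≤ (N w x).card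
    · obtain ⟨x, hx, hw⟩ := hgood
      rcases ih (fun w => N w x) (fun v hv => (Finset.filter_subset _ _).trans (hX v (hS v hv)))
        (fun u hu v hv huv => Finset.disjoint_of_subset_left (Finset.filter_subset _ _)
          (Finset.disjoint_of_subset_right (Finset.filter_subset _ _)
            (hd u (hS u hu) v (hS v hv) huv)))
        (fun v hv => by
          refine (hc v (hS v hv)).trans ?_
          rw [Finset.card_insert_of_notMem ha, pow_succ, mul_assoc]
          exact mul_le_mul_of_nonneg_left (hw v hv) (by positivity)) with ⟨φ, hφ, hadj⟩ | h
      · refine Or.inl ⟨Function.update φ a x, ?_, ?_⟩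
        · intro v hv
          rcases Finset.mem_insert.mp hv with e | hv
          · rw [e, Function.update_self]; exact hx
          · rw [Function.update_of_ne (hav v hv)]
            exact (Finset.mem_filter.mp (hφ v hv)).1
        · intro u hu v hv huv
          rw [Finset.mem_insert] at hu hv
          rcases hu with hu | hu <;> rcases hv with hv | hv
          · rw [hu, hv] at huv
            exact absurd huv (H.irrefl a)
          · rw [hu] at huv ⊢
            rw [Function.update_self, Function.update_of_ne (hav v hv)]
            exact (Finset.mem_filter.mp (hφ v hv)).2.1 huv
          · rw [hv] at huv ⊢
            rw [Function.update_self, Function.update_of_ne (hav u hu)]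
            exact (Finset.mem_filter.mp (hφ u hu)).2.2 huv
          · rw [Function.update_of_ne (hav v hv), Function.update_of_ne (hav u hu)]
            exact hadj u hu v hv huv
      · exact Or.inr h
    · push Not at hgood
      have : Nonempty V := ⟨a⟩
      choose! f hfS hf using hgood
      have hUa : (U a).Nonempty := by
        rw [← Finset.card_pos, ← Nat.cast_pos (α := ℝ)]
        exact hm.trans_le (hbig a haS)
      obtain ⟨x0, hx0⟩ := hUa
      have hSne : S.Nonempty := ⟨_, hfS x0 hx0⟩
      have hScard : (0 : ℝ) < S.card := by exact_mod_cast hSne.card_pos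
      -- Pigeonhole on the vertex at which each candidate fails; this costs the factor `Fintype.card
      -- V` in the bound on `A`.
      obtain ⟨w, hw, hcard⟩ := Finset.exists_le_card_fiber_of_nsmul_le_card_of_maps_to
        (s := U a) (t := S) (f := f) (b := ((U a).card : ℝ) / S.card) hfS hSne (by
          rw [nsmul_eq_mul, mul_div_cancel₀ _ hScard.ne'])
      have hwa : a ≠ w := (hav w hw).symm
      refine Or.inr ⟨(U a).filter (fun x => f x = w), U w,
        (Finset.filter_subset _ _).trans (hX a haS), hX w (hS w hw),
        Finset.disjoint_of_subset_left (Finset.filter_subset _ _) (hd a haS w (hS w hw) hwa),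
        ?_, hbig w (hS w hw), ?_⟩
      · rw [div_le_iff₀ hScard] at hcard
        refine (hbig a haS).trans (hcard.trans ?_)
        rw [mul_comm]
        gcongr
        exact Finset.card_le_univ S
      · have key : ∀ x ∈ (U a).filter (fun x => f x = w), ((N w x).card : ℝ) ≤ lam * (U w).card := by
          intro x hx
          obtain ⟨hxa, rfl⟩ := Finset.mem_filter.mp hx
          exact (hf x hxa).le
        rcases H.total a w hwa with h | h
        · refine Or.inl fun x hx => ?_
          have := key x hx
          simpa [N, h, H.asymm _ _ h] using this
        · refine Or.inr fun x hx => ?_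
          have := key x hx
          simpa [N, h, H.asymm _ _ h] using this

/-- Discarding the vertices of `B` with many `R`-neighbours makes an `R`-sparse pair sparse from
both sides. -/
theorem exists_two_sided_sparse {A B : Finset W} (R : W → W → Prop) {ε : ℝ} (hε : 0 < ε)
    (hA : A.Nonempty)
    (h : ∀ x ∈ A, ((B.filter (fun y => R x y)).card : ℝ) ≤ ε * B.card) :
    ∃ B' ⊆ B, B.card ≤ 2 * B'.card ∧
      (∀ x ∈ A, ((B'.filter (fun y => R x y)).card : ℝ) ≤ 2 * ε * B'.card) ∧
      ∀ y ∈ B', ((A.filter (fun x => R x y)).card : ℝ) ≤ 2 * ε * A.card := by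
  let P : W → Prop := fun y => ((A.filter (fun x => R x y)).card : ℝ) ≤ 2 * ε * A.card
  have hApos : (0 : ℝ) < A.card := by exact_mod_cast hA.card_pos
  have hsplit := Finset.card_filter_add_card_filter_not (s := B) P
  -- Double counting of the `R`-pairs between `A` and `B`: each discarded vertex has more than twice
  -- the permitted average degree, so at most half of `B` is discarded.
  have hbad : ((B.filter (fun y => ¬ P y)).card : ℝ) * (2 * ε * A.card) ≤ A.card * (ε * B.card) := by
    calc ((B.filter (fun y => ¬ P y)).card : ℝ) * (2 * ε * A.card)
        ≤ ∑ y ∈ B.filter (fun y => ¬ P y), ((A.filter (fun x => R x y)).card : ℝ) := by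
          rw [← nsmul_eq_mul]
          exact Finset.card_nsmul_le_sum _ _ _ fun y hy =>
            (not_le.mp (Finset.mem_filter.mp hy).2).le
      _ ≤ ∑ y ∈ B, ((A.filter (fun x => R x y)).card : ℝ) :=
          Finset.sum_le_sum_of_subset_of_nonneg (Finset.filter_subset _ _)
            fun _ _ _ => Nat.cast_nonneg _
      _ = ∑ x ∈ A, ((B.filter (fun y => R x y)).card : ℝ) := by
          have := Finset.sum_card_bipartiteAbove_eq_sum_card_bipartiteBelow (s := A) (t := B) R
          unfold Finset.bipartiteAbove Finset.bipartiteBelow at this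
          exact_mod_cast this.symm
      _ ≤ A.card * (ε * B.card) := by
          rw [← nsmul_eq_mul]
          exact Finset.sum_le_card_nsmul _ _ _ h
  have hbad' : 2 * ((B.filter (fun y => ¬ P y)).card : ℝ) ≤ B.card := by
    have : 0 < ε * A.card := by positivity
    nlinarith
  have hhalf : B.card ≤ 2 * (B.filter P).card := by
    have : 2 * (B.filter (fun y => ¬ P y)).card ≤ B.card := by exact_mod_cast hbad'
    omega
  refine ⟨B.filter P, Finset.filter_subset _ _, hhalf, fun x hx => ?_,
    fun y hy => (Finset.mem_filter.mp hy).2⟩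
  have h2 : (B.card : ℝ) ≤ 2 * (B.filter P).card := by exact_mod_cast hhalf
  calc (((B.filter P).filter (fun y => R x y)).card : ℝ)
      ≤ (B.filter (fun y => R x y)).card := by
        exact_mod_cast Finset.card_le_card (Finset.filter_subset_filter _ (Finset.filter_subset _ _))
    _ ≤ ε * B.card := h x hx
    _ ≤ 2 * ε * (B.filter P).card := by nlinarith

/-- The greedy embedding is run on disjoint equal parts of `U`, one for each vertex of `H`. The
sparse pair it leaves is made two-sided, and the order of its two sets is chosen so that the rare
arcs are the backward ones. -/
theorem exists_sparse_pair [Fintype V] (H : Tournament V) {lam : ℝ} (hlam : 0 < lam) :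
    ∃ c : ℝ, 0 < c ∧ ∃ n₀ : ℕ, ∀ (W : Type v) (T : Tournament W), (¬ ∃ φ, IsHom H T φ) →
      ∀ U : Finset W, n₀ ≤ U.card → ∃ A B : Finset W, A ⊆ U ∧ B ⊆ U ∧ Disjoint A B ∧
        c * U.card ≤ A.card ∧ c * U.card ≤ B.card ∧
        (∀ x ∈ A, ((B.filter (fun y => ¬ T.Adj x y)).card : ℝ) ≤ lam * B.card) ∧
        ∀ y ∈ B, ((A.filter (fun x => ¬ T.Adj x y)).card : ℝ) ≤ lam * A.card := by
  set N := Fintype.card V with hN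
  -- Halved because making the pair two-sided doubles the density.
  set ε := min lam 1 / 2 with hε
  have hε0 : 0 < ε := by positivity
  have hε1 : ε ≤ 1 := by
    have := min_le_right lam 1
    linarith
  have hεl : 2 * ε ≤ lam := by
    have := min_le_left lam 1
    linarith
  -- One factor `2 * (N + 1)` bounds `U.card / q`, rounding included; the other covers the loss of
  -- `N` in `A` and of `2` in `B'`. Using `N + 1` avoids division by zero.
  refine ⟨ε ^ N / (2 * (N + 1)) / (2 * (N + 1)), by positivity, 2 * (N + 1), ?_⟩
  intro W T hT U hU
  have hWne : Nonempty W := by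
    obtain ⟨x, -⟩ := Finset.card_pos.mp (show 0 < U.card by omega)
    exact ⟨x⟩
  set q := U.card / (N + 1) with hq
  have hq1 : (U.card : ℝ) ≤ 2 * (N + 1) * q := by
    have h1 : U.card < (N + 1) * (q + 1) := Nat.lt_mul_div_succ _ (by omega)
    have h2 : 2 ≤ q := (Nat.le_div_iff_mul_le (by omega)).mpr (by omega)
    have h3 : U.card ≤ 2 * (N + 1) * q := by nlinarith
    exact_mod_cast h3
  have hqpos : (0 : ℝ) < q := by
    have : (0 : ℝ) < U.card := by exact_mod_cast (show 0 < U.card by omega)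
    by_contra hneg
    have : (2 * (N + 1) * q : ℝ) ≤ 0 := mul_nonpos_of_nonneg_of_nonpos (by positivity) (not_lt.mp hneg)
    linarith
  obtain ⟨P, hP, hPd⟩ := exists_disjoint_subsets U q (Finset.univ : Finset V) (by
    rw [Finset.card_univ, ← hN]
    exact (Nat.mul_le_mul_right q (Nat.le_succ N)).trans (Nat.mul_div_le _ _))
  set m := ε ^ N * q with hmdef
  have hm : 0 < m := by positivity
  have hcm : ε ^ N / (2 * (N + 1)) / (2 * (N + 1)) * U.card ≤ m / (2 * (N + 1)) := by
    rw [hmdef, div_mul_eq_mul_div]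
    refine div_le_div_of_nonneg_right ?_ (by positivity)
    rw [div_mul_eq_mul_div, div_le_iff₀ (by positivity), mul_assoc]
    gcongr
    linarith
  rcases exists_isHom_or_sparse_pair H T hε0 hε1 hm U Finset.univ P (fun v hv => (hP v hv).1) hPd
    (fun v hv => by rw [(hP v hv).2, Finset.card_univ]) with ⟨φ, -, hφ⟩ | ⟨A, B, hA, hB, hAB, hAm, hBm, h⟩
  · exact absurd ⟨φ, fun u v => hφ u (Finset.mem_univ _) v (Finset.mem_univ _)⟩ hT
  · have hA0 : A.Nonempty := by
      rw [Finset.nonempty_iff_ne_empty]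
      rintro rfl
      simp at hAm
      linarith
    have hAc : m / (2 * (N + 1)) ≤ A.card := by
      rw [div_le_iff₀ (by positivity)]
      have : (0 : ℝ) ≤ A.card := Nat.cast_nonneg _
      nlinarith
    have hBc : ∀ B' : Finset W, B.card ≤ 2 * B'.card → m / (2 * (N + 1)) ≤ B'.card := by
      intro B' h
      have h' : (B.card : ℝ) ≤ 2 * B'.card := by exact_mod_cast h
      rw [div_le_iff₀ (by positivity)]
      have : (0 : ℝ) ≤ N * B'.card := by positivity
      nlinarith
    have hne : ∀ x ∈ A, ∀ y ∈ B, x ≠ y := fun x hx y hy e =>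
      Finset.disjoint_left.mp hAB hx (e ▸ hy)
    have hrev : ∀ x y, x ≠ y → (¬ T.Adj x y ↔ T.Adj y x) := fun x y hxy =>
      ⟨T.adj_of_not_adj hxy, T.asymm _ _⟩
    rcases h with h | h
    · obtain ⟨B', hB', hcard, h1, h2⟩ := exists_two_sided_sparse (fun x y => T.Adj x y) hε0 hA0 h
      refine ⟨B', A, hB'.trans hB, hA, (Finset.disjoint_of_subset_right hB' hAB).symm,
        hcm.trans (hBc B' hcard), hcm.trans hAc, ?_, ?_⟩
      · intro y hy
        rw [Finset.filter_congr (q := fun x => T.Adj x y)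
          (fun x hx => hrev y x (hne x hx y (hB' hy)).symm)]
        exact (h2 y hy).trans (by gcongr)
      · intro x hx
        rw [Finset.filter_congr (q := fun y => T.Adj x y)
          (fun y hy => hrev y x (hne x hx y (hB' hy)).symm)]
        exact (h1 x hx).trans (by gcongr)
    · obtain ⟨B', hB', hcard, h1, h2⟩ := exists_two_sided_sparse (fun x y => T.Adj y x) hε0 hA0 h
      refine ⟨A, B', hA, hB'.trans hB, Finset.disjoint_of_subset_right hB' hAB,
        hcm.trans hAc, hcm.trans (hBc B' hcard), ?_, ?_⟩
      · intro x hx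
        rw [Finset.filter_congr (q := fun y => T.Adj y x)
          (fun y hy => hrev x y (hne x hx y (hB' hy)))]
        exact (h1 x hx).trans (by gcongr)
      · intro y hy
        rw [Finset.filter_congr (q := fun x => T.Adj y x)
          (fun x hx => hrev x y (hne x hx y (hB' hy)))]
        exact (h2 y hy).trans (by gcongr)

/-- `x` in block `i` and `y` in block `j` are joined in the direction of the order of the blocks. -/
def Forward {ι : Type*} [LinearOrder ι] (T : Tournament W) (i j : ι) (x y : W) : Prop :=
  (i < j → T.Adj x y) ∧ (j < i → T.Adj y x)

/-- `x` in block `i` and `y` in block `j` are joined against the order of the blocks. -/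
def Backward {ι : Type*} [LinearOrder ι] (T : Tournament W) (i j : ι) (x y : W) : Prop :=
  (i < j ∧ T.Adj y x) ∨ (j < i ∧ T.Adj x y)

theorem forward_comp {ι κ : Type*} [LinearOrder ι] [LinearOrder κ] (T : Tournament W)
    {f : κ → ι} (hf : StrictMono f) (i j : κ) (x y : W) :
    T.Forward (f i) (f j) x y ↔ T.Forward i j x y := by
  simp only [Forward, hf.lt_iff_lt]

/-- The blocks are disjoint, and every vertex has few non-forward neighbours in each other block. -/
structure SparseBlocks {ι : Type*} [LinearOrder ι] (T : Tournament W) (lam : ℝ)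
    (B : ι → Finset W) : Prop where
  disj : ∀ i j, i ≠ j → Disjoint (B i) (B j)
  sparse : ∀ i j, i ≠ j → ∀ x ∈ B i,
    (((B j).filter (fun y => ¬ T.Forward i j x y)).card : ℝ) ≤ lam * (B j).card

/-- One set of a sparse pair becomes the first block, and the others are found inside the second
set. They occupy at least a fraction `min c 1` of it, so the pair is required to be sparser by that
factor. -/
theorem exists_sparseBlocks_fin [Fintype V] (H : Tournament V) {lam : ℝ} (hlam : 0 < lam) (K : ℕ) :
    ∃ c : ℝ, 0 < c ∧ ∃ n₀ : ℕ, ∀ (W : Type v) (T : Tournament W), (¬ ∃ φ, IsHom H T φ) →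
      ∀ U : Finset W, n₀ ≤ U.card → ∃ B : Fin K → Finset W, T.SparseBlocks lam B ∧
        ∀ i, B i ⊆ U ∧ c * U.card ≤ (B i).card := by
  induction K with
  | zero => exact ⟨1, one_pos, 0, fun W T _ U _ => ⟨Fin.elim0, ⟨fun i => i.elim0, fun i => i.elim0⟩,
      fun i => i.elim0⟩⟩
  | succ K ih =>
    obtain ⟨c, hc, n₀, h⟩ := ih
    obtain ⟨c', hc', n₁, h'⟩ := exists_sparse_pair.{u, v} H (lam := lam * min c 1) (by positivity)
    refine ⟨c' * min c 1, by positivity, max n₁ ⌈(n₀ : ℝ) / c'⌉₊, ?_⟩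
    intro W T hT U hU
    obtain ⟨A, B₀, hA, hB₀, hAB, hAc, hBc, h1, h2⟩ := h' W T hT U ((le_max_left _ _).trans hU)
    have hn : (n₀ : ℝ) ≤ c' * U.card := by
      have h3 : (n₀ : ℝ) / c' ≤ U.card := Nat.ceil_le.mp ((le_max_right _ _).trans hU)
      rw [div_le_iff₀ hc'] at h3
      linarith
    obtain ⟨B, hB, hBU⟩ := h W T hT B₀ (by exact_mod_cast hn.trans hBc)
    have hmin1 : min c 1 ≤ 1 := min_le_right _ _
    have hminc : min c 1 ≤ c := min_le_left _ _
    have hsz : ∀ i, min c 1 * B₀.card ≤ ((B i).card : ℝ) := fun i =>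
      (mul_le_mul_of_nonneg_right hminc (Nat.cast_nonneg _)).trans (hBU i).2
    refine ⟨Fin.cons A B, ⟨?_, ?_⟩, ?_⟩
    · intro i j
      refine Fin.cases ?_ (fun i => ?_) i <;> refine Fin.cases ?_ (fun j => ?_) j
      · intro h; exact absurd rfl h
      · intro _
        exact Finset.disjoint_of_subset_right (hBU j).1 hAB
      · intro _
        exact (Finset.disjoint_of_subset_right (hBU i).1 hAB).symm
      · intro hij
        exact hB.disj i j fun e => hij (e ▸ rfl)
    · intro i j
      refine Fin.cases ?_ (fun i => ?_) i <;> refine Fin.cases ?_ (fun j => ?_) j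
      · intro h; exact absurd rfl h
      · intro _ x hx
        simp only [Fin.cons_zero, Fin.cons_succ] at hx ⊢
        calc (((B j).filter (fun y => ¬ T.Forward 0 j.succ x y)).card : ℝ)
            ≤ (B₀.filter (fun y => ¬ T.Adj x y)).card := by
              refine Nat.cast_le.mpr (Finset.card_le_card fun y hy => ?_)
              rw [Finset.mem_filter] at hy ⊢
              exact ⟨(hBU j).1 hy.1, fun h => hy.2 ⟨fun _ => h, fun h => absurd h (Fin.not_lt_zero _)⟩⟩
          _ ≤ lam * min c 1 * B₀.card := h1 x hx
          _ ≤ lam * (B j).card := by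
              rw [mul_assoc]
              exact mul_le_mul_of_nonneg_left (hsz j) hlam.le
      · intro _ y hy
        simp only [Fin.cons_zero, Fin.cons_succ] at hy ⊢
        calc ((A.filter (fun x => ¬ T.Forward i.succ 0 y x)).card : ℝ)
            ≤ (A.filter (fun x => ¬ T.Adj x y)).card := by
              refine Nat.cast_le.mpr (Finset.card_le_card fun x hx => ?_)
              rw [Finset.mem_filter] at hx ⊢
              exact ⟨hx.1, fun h => hx.2 ⟨fun h => absurd h (Fin.not_lt_zero _), fun _ => h⟩⟩
          _ ≤ lam * min c 1 * A.card := h2 y ((hBU i).1 hy)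
          _ ≤ lam * A.card := by
              refine mul_le_mul_of_nonneg_right ?_ (Nat.cast_nonneg _)
              exact mul_le_of_le_one_right hlam.le hmin1
      · intro hij x hx
        simp only [Fin.cons_succ] at hx ⊢
        refine le_trans (Nat.cast_le.mpr (Finset.card_le_card fun y hy => ?_))
          (hB.sparse i j (fun e => hij (e ▸ rfl)) x hx)
        rw [Finset.mem_filter] at hy ⊢
        exact ⟨hy.1, fun h => hy.2 ((T.forward_comp (Fin.strictMono_succ) i j x y).mpr h)⟩
    · intro i
      refine Fin.cases ?_ (fun i => ?_) i
      · refine ⟨hA, le_trans ?_ hAc⟩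
        refine mul_le_mul_of_nonneg_right ?_ (Nat.cast_nonneg _)
        exact mul_le_of_le_one_right hc'.le hmin1
      · refine ⟨(hBU i).1.trans hB₀, le_trans ?_ (hsz i)⟩
        rw [mul_comm c', mul_assoc]
        exact mul_le_mul_of_nonneg_left hBc (by positivity)

theorem SparseBlocks.comp {ι κ : Type*} [LinearOrder ι] [LinearOrder κ] {T : Tournament W}
    {lam : ℝ} {B : ι → Finset W} (hB : T.SparseBlocks lam B) {f : κ → ι} (hf : StrictMono f) :
    T.SparseBlocks lam (fun k => B (f k)) := by
  refine ⟨fun i j hij => hB.disj _ _ (hf.injective.ne hij), fun i j hij x hx => ?_⟩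
  refine le_trans (Nat.cast_le.mpr (Finset.card_le_card fun y hy => ?_))
    (hB.sparse (f i) (f j) (hf.injective.ne hij) x hx)
  rw [Finset.mem_filter] at hy ⊢
  exact ⟨hy.1, fun h => hy.2 ((T.forward_comp hf i j x y).mp h)⟩

theorem exists_sparseBlocks [Fintype V] (H : Tournament V) {lam : ℝ} (hlam : 0 < lam)
    (ι : Type w) [LinearOrder ι] [Fintype ι] :
    ∃ c : ℝ, 0 < c ∧ ∃ n₀ : ℕ, ∀ (W : Type v) (T : Tournament W), (¬ ∃ φ, IsHom H T φ) →
      ∀ U : Finset W, n₀ ≤ U.card → ∃ B : ι → Finset W, T.SparseBlocks lam B ∧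
        ∀ i, c * U.card ≤ (B i).card := by
  obtain ⟨c, hc, n₀, h⟩ := exists_sparseBlocks_fin.{u, v} H hlam (Fintype.card ι)
  refine ⟨c, hc, n₀, fun W T hT U hU => ?_⟩
  obtain ⟨B, hB, hBU⟩ := h W T hT U hU
  let e := (Fintype.orderIsoFinOfCardEq ι rfl).symm
  exact ⟨fun i => B (e i), hB.comp e.strictMono, fun i => (hBU _).2⟩

/-- Shrinking every block by a bounded factor keeps the blocks sparse. -/
theorem SparseBlocks.shrink {ι : Type*} [LinearOrder ι] {T : Tournament W}
    {lam κ : ℝ} {B C : ι → Finset W} (hB : T.SparseBlocks lam B) (hlam : 0 ≤ lam)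
    (hCB : ∀ i, C i ⊆ B i) (hcard : ∀ i, ((B i).card : ℝ) ≤ κ * (C i).card) :
    T.SparseBlocks (lam * κ) C := by
  refine ⟨fun i j hij => Finset.disjoint_of_subset_left (hCB i)
    (Finset.disjoint_of_subset_right (hCB j) (hB.disj i j hij)), fun i j hij x hx => ?_⟩
  calc (((C j).filter (fun y => ¬ T.Forward i j x y)).card : ℝ)
      ≤ ((B j).filter (fun y => ¬ T.Forward i j x y)).card := by
        exact_mod_cast Finset.card_le_card (Finset.filter_subset_filter _ (hCB j))
    _ ≤ lam * (B j).card := hB.sparse i j hij x (hCB i hx)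
    _ ≤ lam * κ * (C j).card := by
        rw [mul_assoc]
        exact mul_le_mul_of_nonneg_left (hcard j) hlam

end Blocks

/-! ### Backward triangles, brooms and assembling pieces -/

section Embedding

open scoped Classical

variable {V : Type u} {W : Type v}

/-- `T` has no pure pair with `k` vertices on each side. -/
def NoPurePair (T : Tournament W) (k : ℕ) : Prop :=
  ∀ A B : Finset W, T.IsPurePair A B → A.card < k ∨ B.card < k

/-- There are vertices in `X`, `Y`, `Z` all of whose arcs go from a later set to an earlier one. -/
def HasTriangle (T : Tournament W) (X Y Z : Finset W) : Prop :=
  ∃ x ∈ X, ∃ y ∈ Y, ∃ z ∈ Z, T.Adj y x ∧ T.Adj z y ∧ T.Adj z x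

def TriangleFree {ι : Type*} [LinearOrder ι] (T : Tournament W) (B : ι → Finset W) : Prop :=
  ∀ h i j, h < i → i < j → ¬ T.HasTriangle (B h) (B i) (B j)

/-- Triangles survive when each of the three sets loses at most half of its vertices. -/
def RobustTriangle (T : Tournament W) (X Y Z : Finset W) : Prop :=
  ∀ X' ⊆ X, ∀ Y' ⊆ Y, ∀ Z' ⊆ Z, X.card ≤ 2 * X'.card → Y.card ≤ 2 * Y'.card →
    Z.card ≤ 2 * Z'.card → T.HasTriangle X' Y' Z'

theorem HasTriangle.mono {T : Tournament W} {X Y Z X' Y' Z' : Finset W}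
    (h : T.HasTriangle X Y Z) (hX : X ⊆ X') (hY : Y ⊆ Y') (hZ : Z ⊆ Z') :
    T.HasTriangle X' Y' Z' := by
  obtain ⟨x, hx, y, hy, z, hz, hh⟩ := h
  exact ⟨x, hX hx, y, hY hy, z, hZ hz, hh⟩

/-- The triples are treated in turn. A triple that is not robust loses all its triangles on passing
to suitable halves of its three sets, and later shrinking creates none; the process stops at the
first robust triple. -/
theorem exists_triangleFree_or_robust {ι : Type*} [LinearOrder ι] (T : Tournament W)
    (B : ι → Finset W) (τ : Finset (ι × ι × ι)) (hτ : ∀ t ∈ τ, t.1 < t.2.1 ∧ t.2.1 < t.2.2) :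
    ∃ C : ι → Finset W, (∀ i, C i ⊆ B i) ∧ (∀ i, (B i).card ≤ 2 ^ τ.card * (C i).card) ∧
      ((∀ t ∈ τ, ¬ T.HasTriangle (C t.1) (C t.2.1) (C t.2.2)) ∨
        ∃ t ∈ τ, T.RobustTriangle (C t.1) (C t.2.1) (C t.2.2)) := by
  induction τ using Finset.induction_on with
  | empty => exact ⟨B, fun i => subset_rfl, by simp, Or.inl (by simp)⟩
  | insert t τ ht ih =>
    obtain ⟨C, hCB, hcard, h⟩ := ih fun s hs => hτ s (Finset.mem_insert_of_mem hs)
    rw [Finset.card_insert_of_notMem ht, pow_succ]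
    have hle : ∀ i, (B i).card ≤ 2 ^ τ.card * 2 * (C i).card := fun i =>
      (hcard i).trans (Nat.mul_le_mul_right _ (by omega))
    rcases h with h | ⟨s, hs, h⟩
    · by_cases hrob : T.RobustTriangle (C t.1) (C t.2.1) (C t.2.2)
      · exact ⟨C, hCB, hle, Or.inr ⟨t, Finset.mem_insert_self _ _, hrob⟩⟩
      · unfold RobustTriangle at hrob
        push Not at hrob
        obtain ⟨X, hX, Y, hY, Z, hZ, hXc, hYc, hZc, hno⟩ := hrob
        obtain ⟨t1, t2, t3⟩ := t
        obtain ⟨h12, h23⟩ := hτ _ (Finset.mem_insert_self _ _)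
        simp only at h12 h23 hX hY hZ hXc hYc hZc
        let D : ι → Finset W := fun i =>
          if i = t1 then X else if i = t2 then Y else if i = t3 then Z else C i
        have hD1 : D t1 = X := if_pos rfl
        have hD2 : D t2 = Y := by simp [D, h12.ne']
        have hD3 : D t3 = Z := by simp [D, h23.ne', (h12.trans h23).ne']
        have hDC : ∀ i, D i ⊆ C i ∧ (C i).card ≤ 2 * (D i).card := by
          intro i
          by_cases h1 : i = t1
          · rw [h1, hD1]; exact ⟨hX, hXc⟩
          by_cases h2 : i = t2
          · rw [h2, hD2]; exact ⟨hY, hYc⟩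
          by_cases h3 : i = t3
          · rw [h3, hD3]; exact ⟨hZ, hZc⟩
          have : D i = C i := by simp [D, h1, h2, h3]
          rw [this]
          exact ⟨subset_rfl, by omega⟩
        refine ⟨D, fun i => (hDC i).1.trans (hCB i), fun i => ?_, Or.inl fun s hs => ?_⟩
        · rw [mul_assoc]
          exact (hcard i).trans (Nat.mul_le_mul_left _ (hDC i).2)
        · rcases Finset.mem_insert.mp hs with rfl | hs
          · simp only [hD1, hD2, hD3]
            exact hno
          · exact fun hh => h s hs (hh.mono (hDC _).1 (hDC _).1 (hDC _).1)
    · exact ⟨C, hCB, hle, Or.inr ⟨s, Finset.mem_insert_of_mem hs, h⟩⟩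

/-- Blocks are grouped by the vertices of `V`, five to a group. -/
abbrev BlockIndex (V : Type u) := V ×ₗ Fin 5

/-- The preceding dichotomy is applied to a separate family of blocks for each `v`. One
triangle-free family is enough for the first outcome; otherwise every family supplies a robust
triple. Each shrinkable block is followed by a spare one (last coordinate `1`), so that something
lies between the members of a triple. -/
theorem exists_triangleFree_or_robust_blocks [Fintype V] [LinearOrder V] (H : Tournament V)
    {lam : ℝ} (hlam : 0 < lam) :
    ∃ c : ℝ, 0 < c ∧ ∃ n₀ : ℕ, ∀ (W : Type v) [Fintype W] (T : Tournament W),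
      (¬ ∃ φ, IsHom H T φ) → n₀ ≤ Fintype.card W →
      ∃ B : BlockIndex V → Finset W, T.SparseBlocks lam B ∧
        (∀ i, c * Fintype.card W ≤ (B i).card) ∧
        (T.TriangleFree B ∨ ∀ v, T.RobustTriangle (B (toLex (v, 0))) (B (toLex (v, 2)))
          (B (toLex (v, 4)))) := by
  let τ : Finset (BlockIndex V × BlockIndex V × BlockIndex V) := Finset.univ.filter fun t => t.1 < t.2.1 ∧ t.2.1 < t.2.2
  have hτ : ∀ t, t ∈ τ ↔ t.1 < t.2.1 ∧ t.2.1 < t.2.2 := fun t => by simp [τ]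
  set κ : ℝ := 2 ^ τ.card with hκ
  have hκ0 : 0 < κ := by positivity
  have hκ1 : 1 ≤ κ := one_le_pow₀ (by norm_num)
  obtain ⟨c, hc, n₀, h⟩ := exists_sparseBlocks.{u, v} H (lam := lam / κ) (by positivity)
    (V ×ₗ (BlockIndex V ×ₗ Fin 2))
  refine ⟨c / κ, by positivity, n₀, fun W _ T hT hW => ?_⟩
  obtain ⟨B, hB, hBc⟩ := h W T hT Finset.univ (by rwa [Finset.card_univ])
  simp only [Finset.card_univ] at hBc
  choose C hCB hCc hC using fun v : V => T.exists_triangleFree_or_robust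
    (fun j : BlockIndex V => B (toLex (v, toLex (j, 0)))) τ fun t ht => (hτ t).mp ht
  let B' : V ×ₗ (BlockIndex V ×ₗ Fin 2) → Finset W := fun i =>
    if (ofLex (ofLex i).2).2 = 0 then C (ofLex i).1 (ofLex (ofLex i).2).1 else B i
  have hB'C : ∀ v j, B' (toLex (v, toLex (j, 0))) = C v j := fun v j => by simp [B']
  have hB'B : ∀ i, B' i ⊆ B i ∧ ((B i).card : ℝ) ≤ κ * (B' i).card := by
    intro i
    obtain ⟨⟨v, ⟨j, e⟩⟩, rfl⟩ := toLex.surjective i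
    by_cases he : e = 0
    · subst he
      have := hB'C v j
      rw [show B' (toLex (v, (j, 0))) = C v j from this]
      exact ⟨hCB v j, by rw [hκ]; exact_mod_cast hCc v j⟩
    · have : B' (toLex (v, (j, e))) = B (toLex (v, (j, e))) := if_neg he
      rw [this]
      exact ⟨subset_rfl, le_mul_of_one_le_left (Nat.cast_nonneg _) hκ1⟩
  have hsp : T.SparseBlocks lam B' := by
    have := hB.shrink (κ := κ) (by positivity) (fun i => (hB'B i).1) (fun i => (hB'B i).2)
    rwa [div_mul_cancel₀ _ hκ0.ne'] at this
  have hsz : ∀ i, c / κ * Fintype.card W ≤ (B' i).card := by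
    intro i
    rw [div_mul_eq_mul_div, div_le_iff₀ hκ0, mul_comm _ κ]
    exact (hBc i).trans (hB'B i).2
  by_cases hfree : ∃ v, ∀ t ∈ τ, ¬ T.HasTriangle (C v t.1) (C v t.2.1) (C v t.2.2)
  · obtain ⟨v, hv⟩ := hfree
    have hf : StrictMono fun j : BlockIndex V => (toLex (v, toLex (j, (0 : Fin 2))) : V ×ₗ (BlockIndex V ×ₗ Fin 2)) := by
      intro j j' hj
      simp [Prod.Lex.toLex_lt_toLex, hj]
    refine ⟨_, hsp.comp hf, fun i => hsz _, Or.inl fun a b d hab hbd => ?_⟩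
    simp only [hB'C]
    exact hv (a, b, d) ((hτ _).mpr ⟨hab, hbd⟩)
  · push Not at hfree
    have hrob : ∀ v, ∃ t ∈ τ, T.RobustTriangle (C v t.1) (C v t.2.1) (C v t.2.2) := fun v =>
      (hC v).resolve_left fun h => by
        obtain ⟨t, ht, hh⟩ := hfree v
        exact h t ht hh
    choose t ht hrob using hrob
    -- The robust triple takes the even slots; the spare blocks after its first two members take
    -- slots `1` and `3`.
    let s : V → Fin 5 → BlockIndex V ×ₗ Fin 2 := fun v =>
      ![toLex ((t v).1, 0), toLex ((t v).1, 1), toLex ((t v).2.1, 0), toLex ((t v).2.1, 1),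
        toLex ((t v).2.2, 0)]
    have hs : ∀ v, StrictMono (s v) := by
      intro v
      obtain ⟨h1, h2⟩ := (hτ _).mp (ht v)
      refine Fin.strictMono_iff_lt_succ.mpr fun i => ?_
      fin_cases i
      · exact Prod.Lex.toLex_lt_toLex.mpr (Or.inr ⟨rfl, Fin.zero_lt_one⟩)
      · exact Prod.Lex.toLex_lt_toLex.mpr (Or.inl h1)
      · exact Prod.Lex.toLex_lt_toLex.mpr (Or.inr ⟨rfl, Fin.zero_lt_one⟩)
      · exact Prod.Lex.toLex_lt_toLex.mpr (Or.inl h2)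
    have hf : StrictMono fun j : BlockIndex V =>
        (toLex ((ofLex j).1, s (ofLex j).1 (ofLex j).2) : V ×ₗ (BlockIndex V ×ₗ Fin 2)) := by
      intro j j' hj
      obtain ⟨⟨v, k⟩, rfl⟩ := toLex.surjective j
      obtain ⟨⟨v', k'⟩, rfl⟩ := toLex.surjective j'
      rcases Prod.Lex.toLex_lt_toLex.mp hj with h | ⟨h, h'⟩
      · exact Prod.Lex.toLex_lt_toLex.mpr (Or.inl h)
      · simp only at h h'
        subst h
        exact Prod.Lex.toLex_lt_toLex.mpr (Or.inr ⟨rfl, hs _ h'⟩)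
    refine ⟨_, hsp.comp hf, fun i => hsz _, Or.inr fun v => ?_⟩
    have := hrob v
    rw [← hB'C, ← hB'C, ← hB'C] at this
    exact this

/-- Suppose `k` vertices of `C` had fewer than `D` backward neighbours each. Removing all these
neighbours from `A` would leave at least `k` vertices, forming a pure pair with the chosen ones. -/
theorem NoPurePair.card_few_backward_lt {ι : Type*} [LinearOrder ι] {T : Tournament W} {k : ℕ}
    (hT : T.NoPurePair k) {i j : ι} (hij : i ≠ j) {A C : Finset W} (hAC : Disjoint A C) (D : ℕ)
    (hA : (D + 1) * k ≤ A.card) :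
    (C.filter fun y => (A.filter fun x => T.Backward j i y x).card < D).card < k := by
  by_contra hcon
  obtain ⟨C', hC', hC'k⟩ := Finset.exists_subset_card_eq (not_lt.mp hcon)
  let N := C'.biUnion fun y => A.filter fun x => T.Backward j i y x
  have hN : N.card ≤ k * D := by
    rw [← hC'k]
    exact Finset.card_biUnion_le_card_mul _ _ _ fun y hy => (Finset.mem_filter.mp (hC' hy)).2.le
  have hAN : k ≤ (A \ N).card := by
    have := Finset.le_card_sdiff N A
    have h2 : (D + 1) * k = k * D + k := by ring
    omega
  have hCC : C' ⊆ C := hC'.trans (Finset.filter_subset _ _)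
  have hd : Disjoint (A \ N) C' := Finset.disjoint_of_subset_left Finset.sdiff_subset
    (Finset.disjoint_of_subset_right hCC hAC)
  have hnb : ∀ x ∈ A \ N, ∀ y ∈ C', x ≠ y ∧ ¬ T.Backward j i y x := by
    intro x hx y hy
    refine ⟨fun e => Finset.disjoint_left.mp hd hx (e ▸ hy), fun hb => ?_⟩
    rw [Finset.mem_sdiff] at hx
    exact hx.2 (Finset.mem_biUnion.mpr ⟨y, hy, Finset.mem_filter.mpr ⟨hx.1, hb⟩⟩)
  rcases lt_or_gt_of_ne hij with h | h
  · rcases hT (A \ N) C' ⟨hd, fun x hx y hy => by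
      obtain ⟨h1, h2⟩ := hnb x hx y hy
      by_contra h3
      exact h2 (Or.inr ⟨h, T.adj_of_not_adj h1 h3⟩)⟩ with h | h <;> omega
  · rcases hT C' (A \ N) ⟨hd.symm, fun y hy x hx => by
      obtain ⟨h1, h2⟩ := hnb x hx y hy
      by_contra h3
      exact h2 (Or.inl ⟨h, T.adj_of_not_adj h1.symm h3⟩)⟩ with h | h <;> omega

theorem Backward.symm {ι : Type*} [LinearOrder ι] {T : Tournament W} {i j : ι} {x y : W}
    (h : T.Backward i j x y) : T.Backward j i y x := Or.symm h

theorem Backward.adj {ι : Type*} [LinearOrder ι] {T : Tournament W} {i j : ι} {x y : W}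
    (h : T.Backward i j x y) (hij : i < j) : T.Adj y x :=
  h.elim And.right fun h => absurd h.1 hij.asymm

/-- In triangle-free blocks, two backward neighbours of a vertex are joined forward. -/
theorem TriangleFree.not_backward {ι : Type*} [LinearOrder ι] {T : Tournament W}
    {B : ι → Finset W} (hB : T.TriangleFree B) {i j l : ι} (hil : i ≠ l) (hjl : j ≠ l)
    (hij : i < j) {x y z : W} (hx : x ∈ B i) (hy : y ∈ B j) (hz : z ∈ B l)
    (hxz : T.Backward l i z x) (hyz : T.Backward l j z y) : ¬ T.Adj y x := by
  intro hyx
  rcases lt_or_gt_of_ne hil with h1 | h1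
  · rcases lt_or_gt_of_ne hjl with h2 | h2
    · exact hB i j l hij h2 ⟨x, hx, y, hy, z, hz, hyx, hyz.symm.adj h2, hxz.symm.adj h1⟩
    · exact hB i l j h1 h2 ⟨x, hx, z, hz, y, hy, hxz.symm.adj h1, hyz.adj h2, hyx⟩
  · exact hB l i j h1 hij ⟨z, hz, x, hx, y, hy, hxz.adj h1, hyx, hyz.adj (h1.trans hij)⟩

/-- A vertex `z` together with vertices joined to it by arcs against the order of the blocks can
be embedded in large blocks, if the other vertices all lie in one block or the blocks are
triangle-free. -/
theorem NoPurePair.exists_broom [Fintype V] [LinearOrder V] {ι : Type*} [LinearOrder ι]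
    (H : Tournament V) {T : Tournament W} {k : ℕ} (hk : 0 < k) (hT : T.NoPurePair k)
    {B : ι → Finset W} (hd : ∀ i j, i ≠ j → Disjoint (B i) (B j))
    (hsize : ∀ i, (2 ^ Fintype.card V + Fintype.card V + 1) * k ≤ (B i).card)
    (β : V → ι) (Q : Set V) (z : V)
    (hz : ∀ u ∈ Q, u ≠ z → β u ≠ β z ∧ (β u < β z → H.Adj z u) ∧ (β z < β u → H.Adj u z))
    (hQ : ∀ u ∈ Q, ∀ v ∈ Q, u ≠ z → v ≠ z →
      (β u = β v → u < v → H.Adj u v) ∧ (β u < β v → H.Adj u v))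
    (hfree : (∀ u ∈ Q, ∀ v ∈ Q, u ≠ z → v ≠ z → β u = β v) ∨ T.TriangleFree B) :
    ∃ φ : V → W, (∀ u ∈ Q, φ u ∈ B (β u)) ∧
      ∀ u ∈ Q, ∀ v ∈ Q, H.Adj u v → T.Adj (φ u) (φ v) := by
  set N := Fintype.card V with hN
  let I : Finset ι := (Finset.univ.filter fun u => u ∈ Q ∧ u ≠ z).image β
  have hI : I.card ≤ N := Finset.card_image_le.trans (Finset.card_le_univ _)
  have hmemI : ∀ u ∈ Q, u ≠ z → β u ∈ I := fun u hu huz =>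
    Finset.mem_image_of_mem _ (Finset.mem_filter.mpr ⟨Finset.mem_univ _, hu, huz⟩)
  have hIz : ∀ i ∈ I, i ≠ β z := by
    intro i hi
    obtain ⟨u, hu, rfl⟩ := Finset.mem_image.mp hi
    obtain ⟨-, hu, huz⟩ := Finset.mem_filter.mp hu
    exact (hz u hu huz).1
  -- The image of `z` must have `2 ^ N` backward neighbours in every block used by the other
  -- vertices. At most `N * k` vertices violate this.
  let bad : ι → Finset W := fun i =>
    (B (β z)).filter fun y => ((B i).filter fun x => T.Backward (β z) i y x).card < 2 ^ N
  have hbad : (I.biUnion bad).card ≤ N * k := by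
    refine (Finset.card_biUnion_le_card_mul _ _ k fun i hi => ?_).trans (Nat.mul_le_mul_right _ hI)
    refine (hT.card_few_backward_lt (hIz i hi) (hd _ _ (hIz i hi)) _ ?_).le
    refine le_trans (Nat.mul_le_mul_right _ ?_) (hsize i)
    omega
  obtain ⟨y, hyB, hy⟩ : ∃ y ∈ B (β z), y ∉ I.biUnion bad := by
    refine Finset.exists_mem_notMem_of_card_lt_card (hbad.trans_lt ?_)
    refine lt_of_lt_of_le ?_ (hsize (β z))
    exact Nat.mul_lt_mul_of_pos_right (by have := Nat.two_pow_pos N; omega) hk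
  -- The transitive tournament is indexed by all of `V` in its order, so vertices sharing the block
  -- `i` take their own entries and are joined in the right direction.
  have hdeg : ∀ i : ι, ∃ f : V → W, i ∈ I → (∀ u, f u ∈ B i ∧ T.Backward (β z) i y (f u)) ∧
      ∀ u v, u < v → T.Adj (f u) (f v) := by
    intro i
    by_cases hi : i ∈ I
    · have : 2 ^ N ≤ ((B i).filter fun x => T.Backward (β z) i y x).card := by
        by_contra hlt
        exact hy (Finset.mem_biUnion.mpr ⟨i, hi, Finset.mem_filter.mpr ⟨hyB, not_le.mp hlt⟩⟩)
      obtain ⟨f, hf, hadj⟩ := T.exists_transitive (V := V) _ this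
      exact ⟨f, fun _ => ⟨fun u => Finset.mem_filter.mp (hf u), hadj⟩⟩
    · exact ⟨fun _ => y, fun h => absurd h hi⟩
  choose f hf using hdeg
  refine ⟨fun u => if u = z then y else f (β u) u, fun u hu => ?_, fun u hu v hv huv => ?_⟩
  · by_cases huz : u = z
    · simp only [huz, if_true]; exact hyB
    · simp only [huz, if_false]
      exact ((hf _ (hmemI u hu huz)).1 u).1
  · have hne : u ≠ v := fun e => H.irrefl v (e ▸ huv)
    by_cases huz : u = z
    · have hvz : v ≠ z := fun e => hne (huz.trans e.symm)
      simp only [huz, if_true, hvz, if_false]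
      obtain ⟨h1, h2, h3⟩ := hz v hv hvz
      rw [huz] at huv
      have hlt : β v < β z := lt_of_le_of_ne (not_lt.mp fun h => H.asymm _ _ huv (h3 h)) h1
      exact ((hf _ (hmemI v hv hvz)).1 v).2.symm.adj hlt
    · by_cases hvz : v = z
      · simp only [hvz, if_true, huz, if_false]
        obtain ⟨h1, h2, h3⟩ := hz u hu huz
        rw [hvz] at huv
        have hlt : β z < β u :=
          lt_of_le_of_ne (not_lt.mp fun h => H.asymm _ _ huv (h2 h)) h1.symm
        exact ((hf _ (hmemI u hu huz)).1 u).2.adj hlt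
      · simp only [hvz, huz, if_false]
        obtain ⟨h1, h2⟩ := hQ u hu v hv huz hvz
        obtain ⟨h3, h4⟩ := hQ v hv u hu hvz huz
        obtain ⟨hfu, hfu'⟩ := hf _ (hmemI u hu huz)
        obtain ⟨hfv, hfv'⟩ := hf _ (hmemI v hv hvz)
        by_cases hβ : β u = β v
        · have hlt : u < v := lt_of_le_of_ne
            (not_lt.mp fun h => H.asymm _ _ huv (h3 hβ.symm h)) hne
          rw [hβ] at hfu' ⊢
          exact hfu' u v hlt
        · have hlt : β u < β v := lt_of_le_of_ne
            (not_lt.mp fun h => H.asymm _ _ huv (h4 h)) hβ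
          have hfree := hfree.resolve_left fun h => hβ (h u hu v hv huz hvz)
          have hno := hfree.not_backward (hIz _ (hmemI u hu huz)) (hIz _ (hmemI v hv hvz)) hlt
            (hfu u).1 (hfv v).1 hyB (hfu u).2 (hfv v).2
          refine T.adj_of_not_adj (fun e => ?_) hno
          exact Finset.disjoint_left.mp (hd _ _ hβ) (hfu u).1 (e ▸ (hfv v).1)

/-- If the vertices of `H` are partitioned into pieces, each of which embeds robustly in the
blocks, and different pieces use different blocks and are joined forward, then `H` embeds. -/
theorem exists_isHom_of_pieces [Fintype V] {ι P : Type*} [LinearOrder ι] [Finite P] [Nonempty W]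
    (H : Tournament V) {T : Tournament W} {lam : ℝ} {B : ι → Finset W}
    (hB : T.SparseBlocks lam B) (hlam : 0 ≤ lam) (hlamV : 2 * Fintype.card V * lam ≤ 1)
    (β : V → ι) (pc : V → P)
    (hcross : ∀ u v, pc u ≠ pc v → β u ≠ β v ∧ (β u < β v → H.Adj u v))
    (hrob : ∀ p, ∀ B' : ι → Finset W, (∀ i, B' i ⊆ B i) → (∀ i, (B i).card ≤ 2 * (B' i).card) →
      ∃ φ : V → W, (∀ u, pc u = p → φ u ∈ B' (β u)) ∧
        ∀ u v, pc u = p → pc v = p → H.Adj u v → T.Adj (φ u) (φ v)) :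
    ∃ φ : V → W, IsHom H T φ := by
  have := Fintype.ofFinite P
  suffices h : ∀ F : Finset P, ∃ φ : V → W, (∀ u, pc u ∈ F → φ u ∈ B (β u)) ∧
      ∀ u v, pc u ∈ F → pc v ∈ F → H.Adj u v → T.Adj (φ u) (φ v) by
    obtain ⟨φ, -, hφ⟩ := h Finset.univ
    exact ⟨φ, fun u v => hφ u v (Finset.mem_univ _) (Finset.mem_univ _)⟩
  intro F
  induction F using Finset.induction_on with
  | empty => exact ⟨fun _ => Classical.arbitrary W, by simp, by simp⟩
  | insert p F hp ih =>
    obtain ⟨φ, hφB, hφ⟩ := ih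
    -- The deletions are always made from the original blocks, for all vertices embedded so far, so
    -- the total loss never exceeds one half of a block.
    let bad : ι → V → Finset W := fun i v =>
      if pc v ∈ F ∧ β v ≠ i then (B i).filter fun y => ¬ T.Forward (β v) i (φ v) y else ∅
    let B' : ι → Finset W := fun i => B i \ Finset.univ.biUnion (bad i)
    have hbad : ∀ i v, ((bad i v).card : ℝ) ≤ lam * (B i).card := by
      intro i v
      by_cases h : pc v ∈ F ∧ β v ≠ i
      · simp only [bad, if_pos h]
        exact hB.sparse _ _ h.2 _ (hφB v h.1)
      · simp only [bad, if_neg h, Finset.card_empty, Nat.cast_zero]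
        positivity
    have hcard : ∀ i, (B i).card ≤ 2 * (B' i).card := by
      intro i
      have h1 : ((Finset.univ.biUnion (bad i)).card : ℝ) ≤ Fintype.card V * (lam * (B i).card) := by
        calc ((Finset.univ.biUnion (bad i)).card : ℝ) ≤ ∑ v, ((bad i v).card : ℝ) := by
              exact_mod_cast Finset.card_biUnion_le
          _ ≤ ∑ _v : V, lam * (B i).card := Finset.sum_le_sum fun v _ => hbad i v
          _ = Fintype.card V * (lam * (B i).card) := by simp
      have h2 : 2 * ((Finset.univ.biUnion (bad i)).card : ℝ) ≤ (B i).card := by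
        have h3 : (0 : ℝ) ≤ (B i).card := Nat.cast_nonneg _
        nlinarith
      have h3 : 2 * (Finset.univ.biUnion (bad i)).card ≤ (B i).card := by exact_mod_cast h2
      have h4 := Finset.le_card_sdiff (Finset.univ.biUnion (bad i)) (B i)
      simp only [B']
      omega
    obtain ⟨ψ, hψB, hψ⟩ := hrob p B' (fun i => Finset.sdiff_subset) hcard
    have hmix : ∀ u v, pc u ∈ F → pc v = p → T.Forward (β u) (β v) (φ u) (ψ v) := by
      intro u v hu hv
      have hne : β u ≠ β v := (hcross u v fun e => hp (hv ▸ e ▸ hu)).1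
      obtain ⟨h1, h2⟩ := Finset.mem_sdiff.mp (hψB v hv)
      by_contra h3
      refine h2 (Finset.mem_biUnion.mpr ⟨u, Finset.mem_univ _, ?_⟩)
      simp only [bad, if_pos (show pc u ∈ F ∧ β u ≠ β v from ⟨hu, hne⟩)]
      exact Finset.mem_filter.mpr ⟨h1, h3⟩
    have hne : ∀ u, pc u ∈ F → pc u ≠ p := fun u hu e => hp (e ▸ hu)
    have hlt : ∀ u v, pc u ≠ pc v → H.Adj u v → β u < β v := by
      intro u v huv hadj
      obtain ⟨h1, -⟩ := hcross u v huv
      obtain ⟨-, h2⟩ := hcross v u huv.symm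
      exact lt_of_le_of_ne (not_lt.mp fun h => H.asymm _ _ hadj (h2 h)) h1
    refine ⟨fun u => if pc u = p then ψ u else φ u, fun u hu => ?_, fun u v hu hv huv => ?_⟩
    · by_cases h : pc u = p
      · simp only [h, if_true]
        exact Finset.sdiff_subset (hψB u h)
      · simp only [h, if_false]
        exact hφB u (Finset.mem_of_mem_insert_of_ne hu h)
    · by_cases h : pc u = p <;> by_cases h' : pc v = p
      · simp only [h, h', if_true]
        exact hψ u v h h' huv
      · have hv := Finset.mem_of_mem_insert_of_ne hv h'
        simp only [h, h', if_true, if_false]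
        exact (hmix v u hv h).2 (hlt u v (fun e => h' (e ▸ h)) huv)
      · have hu := Finset.mem_of_mem_insert_of_ne hu h
        simp only [h, h', if_true, if_false]
        exact (hmix u v hu h').1 (hlt u v (fun e => h (e.trans h')) huv)
      · simp only [h, h', if_false]
        exact hφ u v (Finset.mem_of_mem_insert_of_ne hu h) (Finset.mem_of_mem_insert_of_ne hv h') huv

end Embedding

/-! ### Roles of vertices and the two partitions into pieces -/

section Kinds

variable {V : Type u} {W : Type v} {G : Type w} {F : Type u}

/-- The role of a vertex in a spiral galaxy with pair-stars `G` and stars `F` (some of them without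
leaves): a golden vertex of a pair-star, the center of a star, or a leaf. The leaves of a
pair-star are attached to its first center (label `false`) or to its last one (label `true`). -/
inductive Kind (G : Type w) (F : Type u)
  | gold (i : G) (k : Fin 5)
  | ctr (f : F)
  | leaf (e : (G × Bool) ⊕ F)

namespace Kind

/-- The center to which the leaves with a given label are attached. -/
def center : (G × Bool) ⊕ F → Kind G F
  | Sum.inl (i, b) => gold i (if b then 4 else 0)
  | Sum.inr f => ctr f

def Arc (κ κ' : Kind G F) : Prop :=
  (∃ e, κ = center e ∧ κ' = leaf e) ∨
    ∃ i, (κ = gold i 0 ∧ κ' = gold i 3) ∨ (κ = gold i 4 ∧ κ' = gold i 1)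

/-- Vertices of these kinds are joined by a backward arc. -/
def Linked (κ κ' : Kind G F) : Prop := Arc κ κ' ∨ Arc κ' κ

def collapse : Kind G F → Kind G F
  | gold i _ => gold i 0
  | κ => κ

def slot : Kind G F → Fin 5
  | gold _ k => k
  | _ => 0

/-- The component of the backward arc digraph. -/
def tree : Kind G F → ((G × Bool) ⊕ F) ⊕ G
  | gold i k => ![Sum.inl (Sum.inl (i, false)), Sum.inl (Sum.inl (i, true)), Sum.inr i,
      Sum.inl (Sum.inl (i, false)), Sum.inl (Sum.inl (i, true))] k
  | ctr f => Sum.inl (Sum.inr f)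
  | leaf e => Sum.inl e

/-- A center is grouped with its leaves only, the three inner golden vertices with each other. -/
def star : Kind G F → ((G × Bool) ⊕ F) ⊕ G
  | gold i k => ![Sum.inl (Sum.inl (i, false)), Sum.inr i, Sum.inr i, Sum.inr i,
      Sum.inl (Sum.inl (i, true))] k
  | ctr f => Sum.inl (Sum.inr f)
  | leaf e => Sum.inl e

/-- The position of the golden vertices in the order `4, 1, 3, 5, 2`. -/
def spiral : Fin 5 → Fin 5 := ![1, 4, 2, 0, 3]

theorem Linked.symm {κ κ' : Kind G F} (h : Linked κ κ') : Linked κ' κ := Or.symm h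

theorem eq_of_collapse_slot {κ κ' : Kind G F} (h : collapse κ = collapse κ')
    (h' : slot κ = slot κ') : κ = κ' := by
  cases κ <;> cases κ' <;> simp_all [collapse, slot]

theorem gold_of_collapse {κ κ' : Kind G F} (h : collapse κ = collapse κ')
    (h' : slot κ ≠ slot κ') : ∃ i, κ = gold i (slot κ) ∧ κ' = gold i (slot κ') := by
  cases κ <;> cases κ' <;> simp_all [collapse, slot]

theorem center_ne_leaf (e e' : (G × Bool) ⊕ F) : center e ≠ leaf e' := by
  rcases e with ⟨i, b⟩ | f <;> simp [center]

theorem tree_center (e : (G × Bool) ⊕ F) : tree (center e) = Sum.inl e := by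
  rcases e with ⟨i, b | b⟩ | f <;> simp [center, tree]

theorem star_center (e : (G × Bool) ⊕ F) : star (center e) = Sum.inl e := by
  rcases e with ⟨i, b | b⟩ | f <;> simp [center, star]

theorem Linked.tree_eq {κ κ' : Kind G F} (h : Linked κ κ') : tree κ = tree κ' := by
  rcases h with (⟨e, rfl, rfl⟩ | ⟨i, ⟨rfl, rfl⟩ | ⟨rfl, rfl⟩⟩) |
    (⟨e, rfl, rfl⟩ | ⟨i, ⟨rfl, rfl⟩ | ⟨rfl, rfl⟩⟩) <;> first | rw [tree_center]; rfl | simp [tree]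

/-- The only links that `star` separates join the first golden vertex to the fourth and the fifth to
the second, within one pair-star. -/
theorem Linked.star_eq_or {κ κ' : Kind G F} (h : Linked κ κ') :
    star κ = star κ' ∨ collapse κ = collapse κ' := by
  rcases h with (⟨e, rfl, rfl⟩ | ⟨i, ⟨rfl, rfl⟩ | ⟨rfl, rfl⟩⟩) |
    (⟨e, rfl, rfl⟩ | ⟨i, ⟨rfl, rfl⟩ | ⟨rfl, rfl⟩⟩) <;>
    first | (rw [star_center]; exact Or.inl rfl) | exact Or.inr rfl

theorem linked_center_of_tree {κ : Kind G F} {e : (G × Bool) ⊕ F} (h : tree κ = Sum.inl e)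
    (hc : κ ≠ center e) : Linked κ (center e) := by
  cases κ with
  | gold i k =>
    fin_cases k <;> simp [tree] at h <;> subst h <;> simp [center] at hc <;>
      simp [Linked, Arc, center]
  | ctr f =>
    simp only [tree, Sum.inl.injEq] at h
    subst h
    exact absurd rfl hc
  | leaf e' =>
    simp only [tree, Sum.inl.injEq] at h
    subst h
    exact Or.inr (Or.inl ⟨_, rfl, rfl⟩)

/-- Together with `linked_center_of_tree` this makes each such component a star in the link graph:
its center is linked to all other members, and every link meets the center. -/
theorem center_of_linked {κ κ' : Kind G F} {e : (G × Bool) ⊕ F} (h : tree κ = Sum.inl e)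
    (hl : Linked κ κ') : κ = center e ∨ κ' = center e := by
  rcases hl with (⟨e, rfl, rfl⟩ | ⟨i, ⟨rfl, rfl⟩ | ⟨rfl, rfl⟩⟩) |
    (⟨e, rfl, rfl⟩ | ⟨i, ⟨rfl, rfl⟩ | ⟨rfl, rfl⟩⟩)
  · rw [tree_center, Sum.inl.injEq] at h
    exact Or.inl (h ▸ rfl)
  · simp [tree] at h
    subst h
    exact Or.inl rfl
  · simp [tree] at h
    subst h
    exact Or.inl rfl
  · simp only [tree, Sum.inl.injEq] at h
    exact Or.inr (h ▸ rfl)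
  · simp [tree] at h
    subst h
    exact Or.inr rfl
  · simp [tree] at h
    subst h
    exact Or.inr rfl

theorem eq_of_tree_inr {κ : Kind G F} {i : G} (h : tree κ = Sum.inr i) : κ = gold i 2 := by
  cases κ with
  | gold j k => fin_cases k <;> simp_all [tree]
  | ctr f => simp [tree] at h
  | leaf e' => simp [tree] at h

theorem eq_of_star_inl {κ : Kind G F} {e : (G × Bool) ⊕ F} (h : star κ = Sum.inl e) :
    κ = center e ∨ κ = leaf e := by
  cases κ with
  | gold i k => fin_cases k <;> simp [star] at h <;> subst h <;> simp [center]
  | ctr f =>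
    simp only [star, Sum.inl.injEq] at h
    subst h
    exact Or.inl rfl
  | leaf e' =>
    simp only [star, Sum.inl.injEq] at h
    subst h
    exact Or.inr rfl

theorem eq_of_star_inr {κ : Kind G F} {i : G} (h : star κ = Sum.inr i) :
    κ = gold i 1 ∨ κ = gold i 2 ∨ κ = gold i 3 := by
  cases κ with
  | gold j k => fin_cases k <;> simp_all [star]
  | ctr f => simp [star] at h
  | leaf e' => simp [star] at h

theorem linked_leaf_leaf {e e' : (G × Bool) ⊕ F} : ¬ Linked (leaf e : Kind G F) (leaf e') := by
  rintro ((⟨e, h, -⟩ | ⟨i, ⟨h, -⟩ | ⟨h, -⟩⟩) | (⟨e, h, -⟩ | ⟨i, ⟨h, -⟩ | ⟨h, -⟩⟩)) <;>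
    first | exact center_ne_leaf _ _ h.symm | simp at h

theorem linked_gold {i : G} {k l : Fin 5} : Linked (gold i k : Kind G F) (gold i l) ↔
    (k = 0 ∧ l = 3) ∨ (k = 4 ∧ l = 1) ∨ (l = 0 ∧ k = 3) ∨ (l = 4 ∧ k = 1) := by
  constructor
  · rintro ((⟨e, h, h'⟩ | ⟨j, ⟨h, h'⟩ | ⟨h, h'⟩⟩) | (⟨e, h, h'⟩ | ⟨j, ⟨h, h'⟩ | ⟨h, h'⟩⟩)) <;>
      simp_all
  · rintro (⟨rfl, rfl⟩ | ⟨rfl, rfl⟩ | ⟨rfl, rfl⟩ | ⟨rfl, rfl⟩)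
    · exact Or.inl (Or.inr ⟨i, Or.inl ⟨rfl, rfl⟩⟩)
    · exact Or.inl (Or.inr ⟨i, Or.inr ⟨rfl, rfl⟩⟩)
    · exact Or.inr (Or.inr ⟨i, Or.inl ⟨rfl, rfl⟩⟩)
    · exact Or.inr (Or.inr ⟨i, Or.inr ⟨rfl, rfl⟩⟩)

/-- In the order `4, 1, 3, 5, 2` the only reversed arcs lie among the three inner golden vertices,
which form one piece; hence golden vertices of different pieces are joined forward. -/
theorem gold_spiral {i : G} {k l : Fin 5} (h : spiral k < spiral l)
    (hs : star (gold i k : Kind G F) ≠ star (gold i l)) :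
    (k < l ∧ ¬ Linked (gold i k : Kind G F) (gold i l)) ∨
      (l < k ∧ Linked (gold i l : Kind G F) (gold i k)) := by
  rw [linked_gold, linked_gold]
  fin_cases k <;> fin_cases l <;> simp [spiral, star] at h hs ⊢

theorem spiral_injective : Function.Injective spiral := by decide

end Kind

/-- The ordering of `V` is a spiral galaxy ordering of `H`, described by the kinds of the
vertices. -/
structure IsSpiralKind [LinearOrder V] (H : Tournament V) (kind : V → Kind G F) : Prop where
  inj : ∀ u v, kind u = kind v → u = v ∨ ∃ e, kind u = .leaf e
  gold : ∀ i k, ∃ v, kind v = .gold i k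
  ctr : ∀ f, ∃ v, kind v = .ctr f
  mono : ∀ u v i k l, kind u = .gold i k → kind v = .gold i l → k < l → u < v
  conv : ∀ κ, {v | (kind v).collapse = κ}.OrdConnected
  arc : ∀ x y, y < x → (H.Adj x y ↔ (kind x).Linked (kind y))

/-- A partition of a finite linear order into intervals has a monotone choice of
representatives. -/
theorem exists_monotone_representative [Finite V] [LinearOrder V] {α : Type*} (c : V → α)
    (hc : ∀ a, {v | c v = a}.OrdConnected) :
    ∃ μ : V → V, Monotone μ ∧ ∀ u v, μ u = μ v ↔ c u = c v := by
  classical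
  have := Fintype.ofFinite V
  have hne : ∀ v, (Finset.univ.filter fun u => c u = c v).Nonempty := fun v => ⟨v, by simp⟩
  let μ : V → V := fun v => (Finset.univ.filter fun u => c u = c v).min' (hne v)
  have hμc : ∀ v, c (μ v) = c v := fun v =>
    (Finset.mem_filter.mp (Finset.min'_mem _ (hne v))).2
  have hμle : ∀ u v, c u = c v → μ v ≤ u := fun u v h =>
    Finset.min'_le _ _ (by simpa using h)
  have hμ : ∀ u v, c u = c v → μ u = μ v := fun u v h =>
    le_antisymm (hμle _ _ ((hμc v).trans h.symm)) (hμle _ _ ((hμc u).trans h))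
  refine ⟨μ, fun u v huv => ?_, fun u v => ⟨fun h => ?_, hμ u v⟩⟩
  · by_contra hlt
    rw [not_le] at hlt
    have := (hc (c v)).out (hμc v) (show c v = c v from rfl)
      ⟨(hlt.trans_le (hμle u u rfl)).le, huv⟩
    exact hlt.ne (hμ u v this).symm
  · rw [← hμc u, h, hμc v]

namespace IsSpiralKind

variable [LinearOrder V] {H : Tournament V} {kind : V → Kind G F}

theorem exists_center (h : H.IsSpiralKind kind) (e : (G × Bool) ⊕ F) :
    ∃ v, kind v = Kind.center e := by
  rcases e with ⟨i, b⟩ | f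
  · exact h.gold i _
  · exact h.ctr f

theorem eq_of_kind_center (h : H.IsSpiralKind kind) {u v : V} {e : (G × Bool) ⊕ F}
    (hu : kind u = Kind.center e) (hv : kind v = Kind.center e) : u = v :=
  (h.inj u v (hu.trans hv.symm)).resolve_right fun ⟨_, he⟩ =>
    Kind.center_ne_leaf _ _ (hu.symm.trans he)

theorem eq_of_kind_gold (h : H.IsSpiralKind kind) {u v : V} {i : G} {k : Fin 5}
    (hu : kind u = Kind.gold i k) (hv : kind v = Kind.gold i k) : u = v :=
  (h.inj u v (hu.trans hv.symm)).resolve_right fun ⟨_, he⟩ => by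
    rw [hu] at he
    cases he

theorem adj_of_not_linked (h : H.IsSpiralKind kind) {u v : V} (huv : u < v)
    (hl : ¬ (kind u).Linked (kind v)) : H.Adj u v := by
  by_contra hadj
  exact hl ((h.arc v u huv).mp (H.adj_of_not_adj huv.ne hadj)).symm

theorem adj_of_linked (h : H.IsSpiralKind kind) {u v : V} (huv : u < v)
    (hl : (kind u).Linked (kind v)) : H.Adj v u := (h.arc v u huv).mpr hl.symm

/-! ### The two embeddings of a spiral galaxy -/

variable [Fintype V] [Finite G] [Finite F] [Nonempty W] {T : Tournament W} {k : ℕ} {lam : ℝ}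
  {B : BlockIndex V → Finset W}

/-- The pieces are the components given by `tree`, in the original order of the golden vertices. A
golden center has backward neighbours in two blocks, its leaf block and that of an inner golden
vertex; triangle-freeness settles the arcs between these. -/
theorem exists_isHom_of_triangleFree (h : H.IsSpiralKind kind) (hk : 0 < k)
    (hT : T.NoPurePair k) (hB : T.SparseBlocks lam B) (hlam : 0 ≤ lam)
    (hlamV : 2 * Fintype.card V * lam ≤ 1)
    (hsize : ∀ i, 2 * ((2 ^ Fintype.card V + Fintype.card V + 1) * k) ≤ (B i).card)
    (hfree : T.TriangleFree B) : ∃ φ : V → W, IsHom H T φ := by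
  obtain ⟨μ, hμ, hμc⟩ := exists_monotone_representative (fun v => (kind v).collapse) h.conv
  -- The block depends only on the kind, so leaves of one center share a block. Golden vertices
  -- share a group and are separated by their slots.
  let β : V → BlockIndex V := fun v => toLex (μ v, (kind v).slot)
  have hβlt : ∀ u v, β u < β v → u < v := by
    intro u v huv
    rcases Prod.Lex.toLex_lt_toLex.mp huv with h1 | ⟨h1, h2⟩
    · exact hμ.reflect_lt h1
    · obtain ⟨i, hi, hj⟩ := Kind.gold_of_collapse ((hμc u v).mp h1) h2.ne
      exact h.mono u v i _ _ hi hj h2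
  have hβeq : ∀ u v, β u = β v → kind u = kind v := by
    intro u v huv
    obtain ⟨h1, h2⟩ := Prod.mk.inj (toLex.injective huv)
    exact Kind.eq_of_collapse_slot ((hμc u v).mp h1) h2
  refine exists_isHom_of_pieces H hB hlam hlamV β (fun v => (kind v).tree) ?_ ?_
  · intro u v huv
    exact ⟨fun e => huv (congrArg Kind.tree (hβeq u v e)), fun hlt =>
      h.adj_of_not_linked (hβlt u v hlt) fun hl => huv hl.tree_eq⟩
  · intro p B' hB' hcard
    have hd : ∀ i j, i ≠ j → Disjoint (B' i) (B' j) := fun i j hij =>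
      Finset.disjoint_of_subset_left (hB' i)
        (Finset.disjoint_of_subset_right (hB' j) (hB.disj i j hij))
    have hsize' : ∀ i, (2 ^ Fintype.card V + Fintype.card V + 1) * k ≤ (B' i).card := by
      intro i
      have h1 := hsize i
      have h2 := hcard i
      omega
    have hfree' : T.TriangleFree B' := fun a b c hab hbc ht =>
      hfree a b c hab hbc (ht.mono (hB' _) (hB' _) (hB' _))
    obtain ⟨z, hz1, hz2⟩ : ∃ z, (∀ u ∈ {u | (kind u).tree = p}, u ≠ z → kind u ≠ kind z ∧
        (kind u).Linked (kind z)) ∧ ∀ u ∈ {u | (kind u).tree = p}, ∀ v, u ≠ z → v ≠ z →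
        ¬ (kind u).Linked (kind v) := by
      rcases p with e | i
      · obtain ⟨z, hz⟩ := h.exists_center e
        refine ⟨z, fun u hu huz => ?_, fun u hu v huz hvz hl => ?_⟩
        · have hne : kind u ≠ Kind.center e := fun e' => huz (h.eq_of_kind_center e' hz)
          rw [hz]
          exact ⟨hne, Kind.linked_center_of_tree hu hne⟩
        · rcases Kind.center_of_linked hu hl with e' | e'
          · exact huz (h.eq_of_kind_center e' hz)
          · exact hvz (h.eq_of_kind_center e' hz)
      · obtain ⟨z, hz⟩ := h.gold i 2
        have hall : ∀ u ∈ {u | (kind u).tree = Sum.inr i}, u = z := fun u hu =>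
          h.eq_of_kind_gold (Kind.eq_of_tree_inr hu) hz
        exact ⟨z, fun u hu huz => absurd (hall u hu) huz,
          fun u hu v huz => absurd (hall u hu) huz⟩
    obtain ⟨φ, hφB, hφ⟩ := hT.exists_broom H hk hd hsize' β {u | (kind u).tree = p} z
      (fun u hu huz => ⟨fun e => (hz1 u hu huz).1 (hβeq u z e),
        fun hlt => h.adj_of_linked (hβlt _ _ hlt) (hz1 u hu huz).2,
        fun hlt => h.adj_of_linked (hβlt _ _ hlt) (hz1 u hu huz).2.symm⟩)
      (fun u hu v _ huz hvz => ⟨fun _ hlt => h.adj_of_not_linked hlt (hz2 u hu v huz hvz),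
        fun hlt => h.adj_of_not_linked (hβlt _ _ hlt) (hz2 u hu v huz hvz)⟩)
      (Or.inr hfree')
    exact ⟨φ, hφB, fun u v hu hv => hφ u hu v hv⟩

/-- The pieces are those of `star`, with golden slots permuted by `spiral`. The inner golden
vertices are placed on a robust triangle, and each center with its leaves is a broom having a single
leaf block. -/
theorem exists_isHom_of_robustTriangle (h : H.IsSpiralKind kind) (hk : 0 < k)
    (hT : T.NoPurePair k) (hB : T.SparseBlocks lam B) (hlam : 0 ≤ lam)
    (hlamV : 2 * Fintype.card V * lam ≤ 1)
    (hsize : ∀ i, 2 * ((2 ^ Fintype.card V + Fintype.card V + 1) * k) ≤ (B i).card)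
    (hrich : ∀ v, T.RobustTriangle (B (toLex (v, 0))) (B (toLex (v, 2))) (B (toLex (v, 4)))) :
    ∃ φ : V → W, IsHom H T φ := by
  obtain ⟨μ, hμ, hμc⟩ := exists_monotone_representative (fun v => (kind v).collapse) h.conv
  let β : V → BlockIndex V := fun v => toLex (μ v, Kind.spiral (kind v).slot)
  have hβlt : ∀ u v, (kind u).collapse ≠ (kind v).collapse → β u < β v → u < v := by
    intro u v hc huv
    rcases Prod.Lex.toLex_lt_toLex.mp huv with h1 | ⟨h1, -⟩
    · exact hμ.reflect_lt h1
    · exact absurd ((hμc u v).mp h1) hc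
  have hβeq : ∀ u v, β u = β v → kind u = kind v := by
    intro u v huv
    obtain ⟨h1, h2⟩ := Prod.mk.inj (toLex.injective huv)
    exact Kind.eq_of_collapse_slot ((hμc u v).mp h1) (Kind.spiral_injective h2)
  have hβkind : ∀ u v, kind u = kind v → β u = β v := by
    intro u v huv
    have : μ u = μ v := (hμc u v).mpr (congrArg Kind.collapse huv)
    simp only [β, this, huv]
  refine exists_isHom_of_pieces H hB hlam hlamV β (fun v => (kind v).star) ?_ ?_
  · intro u v huv
    refine ⟨fun e => huv (congrArg Kind.star (hβeq u v e)), fun hlt => ?_⟩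
    by_cases hc : (kind u).collapse = (kind v).collapse
    · have hsp : Kind.spiral (kind u).slot < Kind.spiral (kind v).slot := by
        rcases Prod.Lex.toLex_lt_toLex.mp hlt with h1 | ⟨-, h2⟩
        · exact absurd ((hμc u v).mpr hc) h1.ne
        · exact h2
      obtain ⟨i, hi, hj⟩ := Kind.gold_of_collapse hc fun e => hsp.ne (congrArg _ e)
      rw [hi, hj] at huv
      rcases Kind.gold_spiral hsp huv with ⟨h1, h2⟩ | ⟨h1, h2⟩
      · exact h.adj_of_not_linked (h.mono u v i _ _ hi hj h1) (by rwa [hi, hj])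
      · exact h.adj_of_linked (h.mono v u i _ _ hj hi h1) (by rwa [hi, hj])
    · exact h.adj_of_not_linked (hβlt u v hc hlt) fun hl => hl.star_eq_or.elim huv hc
  · intro p B' hB' hcard
    have hd : ∀ i j, i ≠ j → Disjoint (B' i) (B' j) := fun i j hij =>
      Finset.disjoint_of_subset_left (hB' i)
        (Finset.disjoint_of_subset_right (hB' j) (hB.disj i j hij))
    have hsize' : ∀ i, (2 ^ Fintype.card V + Fintype.card V + 1) * k ≤ (B' i).card := by
      intro i
      have h1 := hsize i
      have h2 := hcard i
      omega
    rcases p with e | i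
    · obtain ⟨z, hz⟩ := h.exists_center e
      have hleaf : ∀ u ∈ {u | (kind u).star = Sum.inl e}, u ≠ z → kind u = Kind.leaf e :=
        fun u hu huz => (Kind.eq_of_star_inl hu).resolve_left fun e' =>
          huz (h.eq_of_kind_center e' hz)
      have hcol : (Kind.leaf e : Kind G F).collapse ≠ (Kind.center e).collapse := by
        rcases e with ⟨i, b⟩ | f <;> simp [Kind.collapse, Kind.center]
      have hlink : ((Kind.leaf e : Kind G F)).Linked (Kind.center e) :=
        Or.inr (Or.inl ⟨e, rfl, rfl⟩)
      obtain ⟨φ, hφB, hφ⟩ := hT.exists_broom H hk hd hsize' β {u | (kind u).star = Sum.inl e} z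
        (fun u hu huz => by
          have hku := hleaf u hu huz
          refine ⟨fun e' => ?_, fun hlt => ?_, fun hlt => ?_⟩
          · have := hβeq u z e'
            rw [hku, hz] at this
            exact Kind.center_ne_leaf _ _ this.symm
          · exact h.adj_of_linked (hβlt _ _ (by rwa [hku, hz]) hlt) (by rwa [hku, hz])
          · exact h.adj_of_linked (hβlt _ _ (by rw [hku, hz]; exact hcol.symm) hlt)
              (by rw [hku, hz]; exact hlink.symm))
        (fun u hu v hv huz hvz => by
          have hku := hleaf u hu huz
          have hkv := hleaf v hv hvz
          refine ⟨fun _ hlt => h.adj_of_not_linked hlt ?_, fun hlt => ?_⟩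
          · rw [hku, hkv]
            exact Kind.linked_leaf_leaf
          · exact absurd (hβkind u v (hku.trans hkv.symm)) hlt.ne)
        (Or.inl fun u hu v hv huz hvz =>
          hβkind u v ((hleaf u hu huz).trans (hleaf v hv hvz).symm))
      exact ⟨φ, hφB, fun u v hu hv => hφ u hu v hv⟩
    · obtain ⟨z, hz⟩ := h.gold i 2
      obtain ⟨x, hx, y, hy, w, hw, hyx, hwy, hwx⟩ := hrich (μ z) _ (hB' _) _ (hB' _) _ (hB' _)
        (hcard _) (hcard _) (hcard _)
      have hμz : ∀ u l, kind u = Kind.gold i l → β u = toLex (μ z, Kind.spiral l) := by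
        intro u l hu
        have : μ u = μ z := (hμc u z).mpr (by rw [hu, hz]; rfl)
        simp only [β, this, hu, Kind.slot]
      -- Slots `1, 2, 3` go to positions `4, 2, 0`, hence to `w, y, x`. The entries for slots `0`
      -- and `4` are fillers, as this piece has no such vertices.
      refine ⟨fun u => ![x, w, y, x, x] (kind u).slot, fun u hu => ?_, fun u v hu hv huv => ?_⟩
      · rcases Kind.eq_of_star_inr hu with hk' | hk' | hk' <;>
          beta_reduce <;> rw [hμz u _ hk', hk']
        · exact hw
        · exact hy
        · exact hx
      · have hirr : ∀ l, kind u = Kind.gold i l → kind v ≠ Kind.gold i l := fun l h1 h2 => by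
          rw [h.eq_of_kind_gold h1 h2] at huv
          exact H.irrefl _ huv
        have hback : ∀ l m, kind u = Kind.gold i l → kind v = Kind.gold i m → m < l →
            (Kind.gold i m : Kind G F).Linked (Kind.gold i l) := fun l m h1 h2 hml => by
          by_contra hl
          exact H.asymm _ _ huv (h.adj_of_not_linked (h.mono v u i m l h2 h1 hml)
            (by rwa [h1, h2]))
        rcases Kind.eq_of_star_inr hu with h1 | h1 | h1 <;>
          rcases Kind.eq_of_star_inr hv with h2 | h2 | h2 <;>
          beta_reduce <;> rw [h1, h2]
        · exact absurd h2 (hirr _ h1)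
        · exact hwy
        · exact hwx
        · have := Kind.linked_gold.mp (hback _ _ h1 h2 (by decide))
          simp at this
        · exact absurd h2 (hirr _ h1)
        · exact hyx
        · have := Kind.linked_gold.mp (hback _ _ h1 h2 (by decide))
          simp at this
        · have := Kind.linked_gold.mp (hback _ _ h1 h2 (by decide))
          simp at this
        · exact absurd h2 (hirr _ h1)

end IsSpiralKind

/-! ### Choice of constants -/

theorem IsSpiralKind.hasStrongEHProperty [Finite V] [LinearOrder V] [Finite G] [Finite F]
    {H : Tournament V} {kind : V → Kind G F} (h : H.IsSpiralKind kind) :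
    HasStrongEHProperty.{u, v} H := by
  have := Fintype.ofFinite V
  set N := Fintype.card V with hN
  obtain ⟨c, hc, n₀, hblocks⟩ := exists_triangleFree_or_robust_blocks.{u, v} H
    (lam := 1 / (2 * (N + 1))) (by positivity)
  -- Twice the size needed for a broom, since blocks may be halved before a piece is embedded.
  set M : ℕ := 2 * (2 ^ N + N + 1) with hM
  have hM0 : 0 < M := by positivity
  set α : ℝ := min (c / (2 * M)) (1 / (n₀ + 1)) with hα
  have hα0 : 0 < α := by positivity
  refine ⟨α, hα0, fun W _ T hfree hW => ?_⟩
  by_contra hpure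
  have hno : ¬ ∃ φ, IsHom H T φ := fun ⟨φ, hφ⟩ => hfree (contains_of_isHom hφ)
  set n := Fintype.card W with hn
  have hWne : Nonempty W := Fintype.card_pos_iff.mp (by omega)
  -- Otherwise the two ends of any arc are already a sufficiently large pure pair.
  have hαn : 1 < α * n := by
    by_contra hle
    rw [not_lt] at hle
    obtain ⟨x, y, hxy⟩ := Fintype.exists_pair_of_one_lt_card hW
    have hone : ∀ x y, T.Adj x y → False := fun x y hadj => hpure ⟨{x}, {y},
      ⟨by
        rw [Finset.disjoint_singleton]
        rintro rfl
        exact T.irrefl _ hadj, by simpa using hadj⟩, by simpa using hle, by simpa using hle⟩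
    exact (T.total x y hxy).elim (hone x y) (hone y x)
  have hn0 : n₀ ≤ n := by
    have h1 : α * n ≤ 1 / (n₀ + 1) * n :=
      mul_le_mul_of_nonneg_right (min_le_right _ _) (Nat.cast_nonneg _)
    rw [one_div_mul_eq_div] at h1
    have h2 := hαn.trans_le h1
    rw [lt_div_iff₀ (by positivity)] at h2
    have h3 : (n₀ : ℝ) ≤ n := by linarith
    exact_mod_cast h3
  set k := ⌈α * n⌉₊ with hk
  have hk0 : 0 < k := Nat.ceil_pos.mpr (by linarith)
  have hT : T.NoPurePair k := by
    intro A B hAB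
    by_contra hcon
    rw [not_or, not_lt, not_lt] at hcon
    exact hpure ⟨A, B, hAB, Nat.ceil_le.mp hcon.1, Nat.ceil_le.mp hcon.2⟩
  -- Since `α * n > 1`, rounding up at most doubles it; this is the `2` in `c / (2 * M)`.
  have hkM : (M * k : ℝ) ≤ c * n := by
    have h1 : (k : ℝ) < α * n + 1 := Nat.ceil_lt_add_one (by positivity)
    have h2 : α * n ≤ c / (2 * M) * n :=
      mul_le_mul_of_nonneg_right (min_le_left _ _) (Nat.cast_nonneg _)
    have h3 : (k : ℝ) ≤ 2 * (c / (2 * M) * n) := by linarith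
    calc (M * k : ℝ) ≤ M * (2 * (c / (2 * M) * n)) := by gcongr
      _ = c * n := by field_simp
  obtain ⟨B, hB, hBc, hcase⟩ := hblocks W T hno hn0
  have hsize : ∀ i, 2 * ((2 ^ N + N + 1) * k) ≤ (B i).card := by
    intro i
    rw [← mul_assoc, ← hM]
    exact_mod_cast hkM.trans (hBc i)
  have hlam : 2 * (N : ℝ) * (1 / (2 * (N + 1))) ≤ 1 := by
    rw [mul_one_div, div_le_one (by positivity)]
    linarith
  refine hno ?_
  rcases hcase with hcase | hcase
  · exact h.exists_isHom_of_triangleFree hk0 hT hB (by positivity) hlam hsize hcase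
  · exact h.exists_isHom_of_robustTriangle hk0 hT hB (by positivity) hlam hsize hcase

end Kinds

/-! ### From spiral galaxy orderings to kinds -/

section Translation

theorem IsPairStarArcs.one_le_and_le {t a : ℕ} {A : Set (ℕ × ℕ)} (h : IsPairStarArcs t a A) :
    1 ≤ a ∧ a + 4 ≤ t := by
  rcases h with ⟨h1, h2, -⟩ | ⟨rfl, j, h1, h2, -⟩ | ⟨rfl, j, h1, h2, -⟩ <;> omega

/-- The leaves of a pair-star that are joined to the vertex `p` by a backward arc. -/
def pairStarLeaves (a : ℕ) (A : Set (ℕ × ℕ)) (p : ℕ) : Set ℕ :=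
  {k | k ∉ Set.Icc a (a + 4) ∧ ((k, p) ∈ A ∨ (p, k) ∈ A)}

/-- All six shapes of pair-star differ only in which leaves belong to the first center (`P`) and
which to the last (`Q`). -/
theorem IsPairStarArcs.exists_description {t a : ℕ} {A : Set (ℕ × ℕ)}
    (h : IsPairStarArcs t a A) : ∃ P Q : ℕ → Prop,
      (∀ k, 1 ≤ k → k ≤ t → (k < a ∨ a + 4 < k) → (P k ↔ ¬ Q k)) ∧
      ∀ x y, (x, y) ∈ A ↔ (x = a + 3 ∧ y = a) ∨ (x = a + 4 ∧ y = a + 1) ∨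
        (x = a ∧ y < a ∧ P y) ∨ (y = a ∧ a + 4 < x ∧ P x) ∨
        (x = a + 4 ∧ y < a ∧ Q y) ∨ (y = a + 4 ∧ a + 4 < x ∧ Q x) := by
  have hmem : ∀ (A B C : Set (ℕ × ℕ)) (p : ℕ × ℕ), p ∈ A ∪ B ∪ C ↔ p ∈ A ∨ p ∈ B ∨ p ∈ C :=
    fun A B C p => by rw [Set.mem_union, Set.mem_union, or_assoc]
  have hleft : ∀ (p : ℕ) (S : Set ℕ) (x y : ℕ), (x, y) ∈ (fun i => (p, i)) '' S ↔ x = p ∧ y ∈ S :=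
    fun p S x y => by simp [eq_comm, and_comm]
  have hright : ∀ (p : ℕ) (S : Set ℕ) (x y : ℕ),
      (x, y) ∈ (fun i => (i, p)) '' S ↔ y = p ∧ x ∈ S :=
    fun p S x y => by simp [eq_comm, and_comm]
  have hpair : ∀ (p q r s x y : ℕ), (x, y) ∈ ({(p, q), (r, s)} : Set (ℕ × ℕ)) ↔
      (x = p ∧ y = q) ∨ (x = r ∧ y = s) := fun p q r s x y => by simp
  rcases h with ⟨h1, h2, rfl | rfl⟩ | ⟨rfl, j, h1, h2, rfl | rfl⟩ | ⟨rfl, j, h1, h2, rfl | rfl⟩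
  · refine ⟨fun k => 1 ≤ k ∧ k < a, fun k => a + 5 ≤ k ∧ k ≤ t, fun k _ _ _ => by omega,
      fun x y => ?_⟩
    rw [hmem, hpair, hleft, hright, Set.mem_Ico, Set.mem_Icc]
    constructor
    · rintro ((h | h) | h | h) <;> grind
    · rintro (h | h | h | h | h | h) <;> grind
  · refine ⟨fun k => a + 5 ≤ k ∧ k ≤ t, fun k => 1 ≤ k ∧ k < a, fun k _ _ _ => by omega,
      fun x y => ?_⟩
    rw [hmem, hpair, hleft, hright, Set.mem_Ico, Set.mem_Icc]
    constructor
    · rintro ((h | h) | h | h) <;> grind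
    · rintro (h | h | h | h | h | h) <;> grind
  · refine ⟨fun k => j + 1 ≤ k ∧ k ≤ t, fun k => 6 ≤ k ∧ k ≤ j, fun k _ _ _ => by omega,
      fun x y => ?_⟩
    rw [hmem, hpair, hright, hright, Set.mem_Icc, Set.mem_Icc]
    constructor
    · rintro ((h | h) | h | h) <;> grind
    · rintro (h | h | h | h | h | h) <;> grind
  · refine ⟨fun k => 6 ≤ k ∧ k ≤ j, fun k => j + 1 ≤ k ∧ k ≤ t, fun k _ _ _ => by omega,
      fun x y => ?_⟩
    rw [hmem, hpair, hright, hright, Set.mem_Icc, Set.mem_Icc]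
    constructor
    · rintro ((h | h) | h | h) <;> grind
    · rintro (h | h | h | h | h | h) <;> grind
  · refine ⟨fun k => 1 ≤ k ∧ k ≤ j, fun k => j + 1 ≤ k ∧ k < a, fun k _ _ _ => by omega,
      fun x y => ?_⟩
    rw [hmem, hpair, hleft, hleft, Set.mem_Icc, Set.mem_Icc]
    constructor
    · rintro ((h | h) | h | h) <;> grind
    · rintro (h | h | h | h | h | h) <;> grind
  · refine ⟨fun k => j + 1 ≤ k ∧ k < a, fun k => 1 ≤ k ∧ k ≤ j, fun k _ _ _ => by omega,
      fun x y => ?_⟩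
    rw [hmem, hpair, hleft, hleft, Set.mem_Icc, Set.mem_Icc]
    constructor
    · rintro ((h | h) | h | h) <;> grind
    · rintro (h | h | h | h | h | h) <;> grind

/-- The predicates `P` and `Q` are recovered from `A` as the leaf sets whose consecutiveness
`IsPairStar` demands. -/
theorem IsPairStarArcs.leaves_and_mem_iff {t a : ℕ} {A : Set (ℕ × ℕ)} (h : IsPairStarArcs t a A) :
    (∀ k, 1 ≤ k → k ≤ t → k ∉ Set.Icc a (a + 4) →
      (k ∈ pairStarLeaves a A a ↔ k ∉ pairStarLeaves a A (a + 4))) ∧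
    ∀ x y, y < x → ((x, y) ∈ A ↔
      (x = a ∧ y ∈ pairStarLeaves a A a) ∨ (x = a + 4 ∧ y ∈ pairStarLeaves a A (a + 4)) ∨
      (y = a ∧ x ∈ pairStarLeaves a A a) ∨ (y = a + 4 ∧ x ∈ pairStarLeaves a A (a + 4)) ∨
      (y = a ∧ x = a + 3) ∨ (x = a + 4 ∧ y = a + 1)) := by
  obtain ⟨P, Q, hPQ, hA⟩ := h.exists_description
  have hgold : ∀ k, k ∉ Set.Icc a (a + 4) ↔ k < a ∨ a + 4 < k := fun k => by
    rw [Set.mem_Icc]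
    omega
  have hP : ∀ k, k ∈ pairStarLeaves a A a ↔ (k < a ∨ a + 4 < k) ∧ P k := by
    intro k
    change _ ∧ _ ↔ _
    rw [hgold, hA, hA]
    grind
  have hQ : ∀ k, k ∈ pairStarLeaves a A (a + 4) ↔ (k < a ∨ a + 4 < k) ∧ Q k := by
    intro k
    change _ ∧ _ ↔ _
    rw [hgold, hA, hA]
    grind
  refine ⟨fun k h1 h2 h3 => ?_, fun x y hyx => ?_⟩
  · rw [hP, hQ]
    have := (hgold k).mp h3
    have := hPQ k h1 h2 this
    grind
  · rw [hA, hP, hP, hQ, hQ]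
    clear hA hP hQ hgold hPQ
    constructor
    · rintro (h | h | h | h | h | h) <;> grind
    · rintro (h | h | h | h | h | h) <;> grind

variable {V : Type u} [LinearOrder V] {H : Tournament V}

theorem isBackwardArc_iff_adj {x y : V} (h : y < x) : H.IsBackwardArc x y ↔ H.Adj x y :=
  ⟨And.left, fun h' => ⟨h', h⟩⟩

/-- The pairs of vertices of a pair-star with golden vertices `g` and leaves `Λ` that are joined by
a backward arc. -/
def PairStarLink (g : Fin 5 → V) (Λ : Bool → Set V) (x y : V) : Prop :=
  (∃ b : Bool, x = g (if b then 4 else 0) ∧ y ∈ Λ b) ∨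
    (x = g 0 ∧ y = g 3) ∨ (x = g 4 ∧ y = g 1)

theorem IsPairStar.exists_golden_leaves {S : Set V} (h : H.IsPairStar S) :
    ∃ (g : Fin 5 → V) (Λ : Bool → Set V), StrictMono g ∧ (Set.range g).OrdConnected ∧
      (∀ b, (Λ b).OrdConnected) ∧ (∀ x, x ∈ S ↔ (∃ k, x = g k) ∨ ∃ b, x ∈ Λ b) ∧
      (∀ b k, g k ∉ Λ b) ∧ (∀ x, x ∈ Λ false → x ∉ Λ true) ∧
      ∀ x ∈ S, ∀ y ∈ S, y < x → (H.Adj x y ↔ PairStarLink g Λ x y ∨ PairStarLink g Λ y x) := by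
  obtain ⟨t, a, A, w, hw, rfl, hA, hback, hgold, hleaf⟩ := h
  obtain ⟨ha1, hat⟩ := hA.one_le_and_le
  obtain ⟨hAleaves, hAmem⟩ := hA.leaves_and_mem_iff
  have hidx : ∀ k : Fin 5, a - 1 + (k : ℕ) < t := fun k => by have := k.isLt; omega
  -- Vertices are numbered from `1` in `A` but indexed from `0` by `w`, hence `a - 1`.
  let g : Fin 5 → V := fun k => w ⟨a - 1 + k, hidx k⟩
  let p : Bool → ℕ := fun b => a + if b then 4 else 0
  let Λ : Bool → Set V := fun b => w '' {k | (k : ℕ) + 1 ∈ pairStarLeaves a A (p b)}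
  have hg : ∀ i k, w i = g k ↔ (i : ℕ) + 1 = a + k := by
    intro i k
    rw [hw.injective.eq_iff, Fin.ext_iff]
    simp only
    omega
  have hΛ : ∀ i b, w i ∈ Λ b ↔ (i : ℕ) + 1 ∈ pairStarLeaves a A (p b) := fun i b =>
    hw.injective.mem_set_image
  have hgk : ∀ k : Fin 5, ((⟨a - 1 + k, hidx k⟩ : Fin t) : ℕ) + 1 = a + k := fun k => by
    simp only
    omega
  have hrange : Set.range g = w '' {k | (k : ℕ) + 1 ∈ Set.Icc a (a + 4)} := by
    ext x
    constructor
    · rintro ⟨k, rfl⟩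
      refine ⟨_, ?_, rfl⟩
      have := k.isLt
      simp only [Set.mem_ofPred_eq, Set.mem_Icc]
      omega
    · rintro ⟨i, hi, rfl⟩
      simp only [Set.mem_ofPred_eq, Set.mem_Icc] at hi
      exact ⟨⟨i + 1 - a, by omega⟩, ((hg _ _).mpr (by simp only; omega)).symm⟩
  refine ⟨g, Λ, fun k l hkl => hw (Fin.mk_lt_mk.mpr (by
    have : (k : ℕ) < l := hkl
    omega)), hrange ▸ hgold, fun b => hleaf (p b) ?_, ?_, ?_, ?_, ?_⟩
  · cases b <;> simp [p]
  · intro x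
    constructor
    · rintro ⟨i, rfl⟩
      by_cases hi : (i : ℕ) + 1 ∈ Set.Icc a (a + 4)
      · left
        have : w i ∈ Set.range g := hrange ▸ ⟨i, hi, rfl⟩
        obtain ⟨k, hk⟩ := this
        exact ⟨k, hk.symm⟩
      · right
        have := hAleaves (i + 1) (by omega) (by have := i.isLt; omega) hi
        by_cases h1 : (i : ℕ) + 1 ∈ pairStarLeaves a A a
        · exact ⟨false, (hΛ i false).mpr h1⟩
        · exact ⟨true, (hΛ i true).mpr (not_not.mp (mt this.mpr h1))⟩
    · rintro (⟨k, rfl⟩ | ⟨b, i, -, rfl⟩)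
      · exact ⟨_, rfl⟩
      · exact ⟨_, rfl⟩
  · intro b k hk
    have h1 := ((hΛ _ b).mp hk).1
    rw [hgk, Set.mem_Icc] at h1
    have := k.isLt
    omega
  · rintro x ⟨i, hi, rfl⟩ hx
    have hx := (hΛ i true).mp hx
    exact (hAleaves _ (by omega) (by have := i.isLt; omega) hi.1).mp hi hx
  · rintro x ⟨i, rfl⟩ y ⟨j, rfl⟩ hji
    rw [← isBackwardArc_iff_adj hji, hback]
    have hji' : (j : ℕ) < i := hw.lt_iff_lt.mp hji
    rw [hAmem _ _ (by omega)]
    simp only [PairStarLink, hg, hΛ, Bool.exists_bool, p, Fin.val_zero, Fin.val_one,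
      show ((3 : Fin 5) : ℕ) = 3 from rfl, show ((4 : Fin 5) : ℕ) = 4 from rfl, add_zero, if_true,
      Bool.false_eq_true, if_false]
    grind

/-- The backward arcs of a left or right star join its center to its leaves. -/
theorem adj_iff_of_star {c : V} {L : Set V} (h : H.IsRightStar c L ∨ H.IsLeftStar c L) {x y : V}
    (hx : x ∈ insert c L) (hy : y ∈ insert c L) (hyx : y < x) :
    H.Adj x y ↔ (x = c ∧ y ∈ L) ∨ (y = c ∧ x ∈ L) := by
  rw [← isBackwardArc_iff_adj hyx]
  rcases h with ⟨-, hlt, hb⟩ | ⟨-, hlt, hb⟩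
  · rw [hb x hx y hy]
    refine ⟨Or.inl, fun h => h.resolve_right ?_⟩
    rintro ⟨rfl, hxL⟩
    exact (hlt x hxL).asymm hyx
  · rw [hb x hx y hy]
    refine ⟨fun h => Or.inr h.symm, fun h => (h.resolve_left ?_).symm⟩
    rintro ⟨rfl, hyL⟩
    exact (hlt y hyL).asymm hyx

theorem center_notMem_leaves {c : V} {L : Set V} (h : H.IsRightStar c L ∨ H.IsLeftStar c L) :
    c ∉ L := fun hc => by
  rcases h with ⟨-, hlt, -⟩ | ⟨-, hlt, -⟩ <;> exact lt_irrefl c (hlt c hc)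

/-- A spiral galaxy ordering assigns kinds to the vertices; every vertex of the path-galaxy that
is not a leaf counts as the center of a star. -/
theorem IsSpiralGalaxyOrdering.exists_isSpiralKind (h : H.IsSpiralGalaxyOrdering) :
    ∃ (l : ℕ) (F : Set V) (kind : V → Kind (Fin l) F), H.IsSpiralKind kind := by
  obtain ⟨l, S, X, hS, hSd, hSX, hcov, hback, ⟨m, c, L, ⟨hgal, -⟩, hLconv⟩, -⟩ := h
  choose g Λ hgmono hgconv hΛconv hSmem hgΛ hΛd harc using fun i => (hS i).exists_golden_leaves
  let M : Fin m → Set V := fun j => Subtype.val '' L j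
  have hcX : ∀ j, (c j : V) ∈ X := fun j => (c j).2
  have hMX : ∀ j, ∀ x ∈ M j, x ∈ X := by
    rintro j _ ⟨x, -, rfl⟩
    exact x.2
  have hval : ∀ j (x : X), (x : V) ∈ M j ↔ x ∈ L j := fun j x =>
    Subtype.val_injective.mem_set_image
  have hMd : ∀ i j x, x ∈ M i → x ∈ M j → i = j := by
    rintro i j _ ⟨x, hx, rfl⟩ hj
    by_contra hij
    exact Set.disjoint_left.mp (hgal.disjoint i j hij) (Or.inr hx) (Or.inr ((hval j x).mp hj))
  have hcM : ∀ i j, (c i : V) ∉ M j := by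
    intro i j hj
    rw [hval] at hj
    by_cases hij : i = j
    · subst hij
      exact center_notMem_leaves (hgal.star i) hj
    · exact Set.disjoint_left.mp (hgal.disjoint i j hij) (Or.inl rfl) (Or.inr hj)
  have hcinj : ∀ i j, (c i : V) = c j → i = j := by
    intro i j hij
    by_contra hne
    exact Set.disjoint_left.mp (hgal.disjoint i j hne) (Or.inl rfl)
      (Or.inl (Subtype.val_injective hij))
  have hstar : ∀ j, ∀ x ∈ insert (c j : V) (M j), ∀ y ∈ insert (c j : V) (M j), y < x →
      (H.Adj x y ↔ (x = c j ∧ y ∈ M j) ∨ (y = c j ∧ x ∈ M j)) := by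
    intro j x hx y hy hyx
    have hX : ∀ x ∈ insert (c j : V) (M j), x ∈ X := by
      rintro x (rfl | hx)
      · exact hcX j
      · exact hMX j x hx
    lift x to X using hX x hx
    lift y to X using hX y hy
    have hins : ∀ x : X, (x : V) ∈ insert (c j : V) (M j) → x ∈ insert (c j) (L j) := by
      rintro x (hx | hx)
      · exact Or.inl (Subtype.val_injective hx)
      · exact Or.inr ((hval j x).mp hx)
    rw [hval, hval, Subtype.val_inj, Subtype.val_inj]
    exact adj_iff_of_star (hgal.star j) (hins x hx) (hins y hy) hyx
  have hbackX : ∀ x ∈ X, ∀ y ∈ X, y < x → H.Adj x y →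
      ∃ j, x ∈ insert (c j : V) (M j) ∧ y ∈ insert (c j : V) (M j) := by
    intro x hx y hy hyx hadj
    obtain ⟨j, h1, h2⟩ := hgal.backward ⟨x, hx⟩ ⟨y, hy⟩ ⟨hadj, hyx⟩
    refine ⟨j, ?_, ?_⟩
    · exact h1.imp (congrArg Subtype.val) (hval j ⟨x, hx⟩).mpr
    · exact h2.imp (congrArg Subtype.val) (hval j ⟨y, hy⟩).mpr
  -- Vertices on no backward arc are included, as centers with empty leaf sets.
  let F : Set V := {x | x ∈ X ∧ ∀ j, x ∉ M j}
  let c' : Fin m → F := fun j => ⟨c j, hcX j, hcM j⟩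
  let leaves : (Fin l × Bool) ⊕ F → Set V := fun e =>
    match e with
    | Sum.inl (i, b) => Λ i b
    | Sum.inr f => {v | ∃ j, (c j : V) = f ∧ v ∈ M j}
  let R : V → Kind (Fin l) F → Prop := fun v κ =>
    match κ with
    | .gold i k => v = g i k
    | .ctr f => v = f
    | .leaf e => v ∈ leaves e
  have hgS : ∀ i k, g i k ∈ S i := fun i k => (hSmem i _).mpr (Or.inl ⟨k, rfl⟩)
  have hΛS : ∀ i b, ∀ x ∈ Λ i b, x ∈ S i := fun i b x hx => (hSmem i x).mpr (Or.inr ⟨b, hx⟩)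
  have hSS : ∀ i j x, x ∈ S i → x ∈ S j → i = j := fun i j x hi hj => by
    by_contra hij
    exact Set.disjoint_left.mp (hSd i j hij) hi hj
  have hSX' : ∀ i x, x ∈ S i → x ∉ X := fun i x hi => Set.disjoint_left.mp (hSX i) hi
  have hlX : ∀ (f : F) x, x ∈ leaves (Sum.inr f) → x ∈ X := by
    rintro f x ⟨j, -, hx⟩
    exact hMX j x hx
  have hexists : ∀ v, ∃ κ, R v κ := by
    intro v
    have hv : v ∈ (⋃ i, S i) ∪ X := hcov ▸ Set.mem_univ v
    rcases hv with hv | hv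
    · obtain ⟨i, hi⟩ := Set.mem_iUnion.mp hv
      rcases (hSmem i v).mp hi with ⟨k, hk⟩ | ⟨b, hb⟩
      · exact ⟨.gold i k, hk⟩
      · exact ⟨.leaf (Sum.inl (i, b)), hb⟩
    · by_cases hM : ∃ j, v ∈ M j
      · obtain ⟨j, hj⟩ := hM
        exact ⟨.leaf (Sum.inr (c' j)), j, rfl, hj⟩
      · exact ⟨.ctr ⟨v, hv, not_exists.mp hM⟩, rfl⟩
  choose kind hkind using hexists
  have hRX : ∀ v κ i, R v κ → v ∈ S i → (∃ k, κ = .gold i k) ∨ ∃ b, κ = .leaf (Sum.inl (i, b)) := by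
    rintro v (⟨j, k⟩ | f | ⟨⟨j, b⟩ | f⟩) i hR hi
    · have : v = g j k := hR
      subst this
      exact Or.inl ⟨k, by rw [hSS _ _ _ hi (hgS j k)]⟩
    · have : v = f := hR
      exact absurd (this ▸ f.2.1) (hSX' i v hi)
    · exact Or.inr ⟨b, by rw [hSS _ _ _ hi (hΛS j b v hR)]⟩
    · exact absurd (hlX f v hR) (hSX' i v hi)
  have hRM : ∀ v κ j, R v κ → v ∈ M j → κ = .leaf (Sum.inr (c' j)) := by
    rintro v (⟨i, k⟩ | f | ⟨⟨i, b⟩ | f⟩) j hR hj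
    · have : v = g i k := hR
      exact absurd (hMX j v hj) (hSX' i v (this ▸ hgS i k))
    · have : v = f := hR
      exact absurd (this ▸ hj) (f.2.2 j)
    · exact absurd (hMX j v hj) (hSX' i v (hΛS i b v hR))
    · obtain ⟨j', hj', hv⟩ := hR
      rw [hMd _ _ _ hj hv]
      exact congrArg _ (congrArg _ (Subtype.ext hj'.symm))
  have hRF : ∀ v κ (f : F), R v κ → v = f → κ = .ctr f := by
    rintro v (⟨i, k⟩ | f' | ⟨⟨i, b⟩ | f'⟩) f hR hf
    · have : v = g i k := hR
      exact absurd (hf ▸ f.2.1) (hSX' i v (this ▸ hgS i k))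
    · have : v = f' := hR
      exact congrArg _ (Subtype.ext (this.symm.trans hf))
    · exact absurd (hf ▸ f.2.1) (hSX' i v (hΛS i b v hR))
    · obtain ⟨j', hj', hv⟩ := hR
      exact absurd (hf ▸ hv) (f.2.2 j')
  -- Roles are unique because the pair-stars, `X`, and the stars inside `X` are disjoint; so the
  -- chosen `kind` is the only one compatible with `R`.
  have hiff : ∀ v κ, kind v = κ ↔ R v κ := by
    refine fun v κ => ⟨fun h => h ▸ hkind v, fun h => ?_⟩
    rcases κ with ⟨i, k⟩ | f | ⟨⟨i, b⟩ | f⟩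
    · have hv : v = g i k := h
      rcases hRX v _ i (hkind v) (hv ▸ hgS i k) with ⟨k', hk'⟩ | ⟨b, hb⟩
      · have h2 : R v (.gold i k') := hk' ▸ hkind v
        have h3 : g i k' = g i k := (show v = g i k' from h2).symm.trans hv
        rw [hk', (hgmono i).injective h3]
      · have h2 : R v (.leaf (Sum.inl (i, b))) := hb ▸ hkind v
        exact absurd (hv ▸ h2 : g i k ∈ Λ i b) (hgΛ i b k)
    · exact hRF v _ f (hkind v) h
    · have hv : v ∈ Λ i b := h
      rcases hRX v _ i (hkind v) (hΛS i b v hv) with ⟨k', hk'⟩ | ⟨b', hb⟩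
      · have h2 : R v (.gold i k') := hk' ▸ hkind v
        exact absurd ((show v = g i k' from h2) ▸ hv) (hgΛ i b k')
      · have h2 : R v (.leaf (Sum.inl (i, b'))) := hb ▸ hkind v
        have h2 : v ∈ Λ i b' := h2
        have : b' = b := by
          cases b <;> cases b' <;> first | rfl | exact absurd h2 (hΛd i v hv) |
            exact absurd hv (hΛd i v h2)
        rw [hb, this]
    · obtain ⟨j, hj, hv⟩ := h
      rw [hRM v _ j (hkind v) hv]
      exact congrArg _ (congrArg _ (Subtype.ext hj))
  have hcenter : ∀ v i b, kind v = Kind.center (Sum.inl (i, b)) ↔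
      v = g i (if b then 4 else 0) := fun v i b => hiff v _
  have hlink : ∀ i x y, PairStarLink (g i) (Λ i) x y → (kind x).Arc (kind y) := by
    rintro i x y (⟨b, h1, h2⟩ | ⟨h1, h2⟩ | ⟨h1, h2⟩)
    · exact Or.inl ⟨Sum.inl (i, b), (hcenter x i b).mpr h1, (hiff y _).mpr h2⟩
    · exact Or.inr ⟨i, Or.inl ⟨(hiff x _).mpr h1, (hiff y _).mpr h2⟩⟩
    · exact Or.inr ⟨i, Or.inr ⟨(hiff x _).mpr h1, (hiff y _).mpr h2⟩⟩
  have hunlink : ∀ x y, (kind x).Arc (kind y) →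
      (∃ i, x ∈ S i ∧ y ∈ S i ∧ PairStarLink (g i) (Λ i) x y) ∨
        ∃ j, x = c j ∧ y ∈ M j := by
    rintro x y (⟨⟨i, b⟩ | f, h1, h2⟩ | ⟨i, ⟨h1, h2⟩ | ⟨h1, h2⟩⟩)
    · have h1 : x = g i _ := (hcenter x i b).mp h1
      have h2 : y ∈ Λ i b := (hiff y _).mp h2
      exact Or.inl ⟨i, h1 ▸ hgS i _, hΛS i b y h2, Or.inl ⟨b, h1, h2⟩⟩
    · have h1 : x = f := (hiff x _).mp h1
      obtain ⟨j, hj, h2⟩ := (hiff y _).mp h2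
      exact Or.inr ⟨j, h1.trans hj.symm, h2⟩
    · have h1 : x = g i _ := (hiff x _).mp h1
      have h2 : y = g i _ := (hiff y _).mp h2
      exact Or.inl ⟨i, h1 ▸ hgS i _, h2 ▸ hgS i _, Or.inr (Or.inl ⟨h1, h2⟩)⟩
    · have h1 : x = g i _ := (hiff x _).mp h1
      have h2 : y = g i _ := (hiff y _).mp h2
      exact Or.inl ⟨i, h1 ▸ hgS i _, h2 ▸ hgS i _, Or.inr (Or.inr ⟨h1, h2⟩)⟩
  have hMarc : ∀ j (x y : V), x = c j → y ∈ M j → (kind x).Arc (kind y) := fun j x y hx hy =>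
    Or.inl ⟨Sum.inr (c' j), (hiff x (.ctr (c' j))).mpr hx, (hiff y _).mpr ⟨j, rfl, hy⟩⟩
  refine ⟨l, F, kind, ⟨?_, ?_, ?_, ?_, ?_, ?_⟩⟩
  · intro u v huv
    cases hv : kind v with
    | gold i k =>
      have h1 : v = g i k := (hiff v _).mp hv
      have h2 : u = g i k := (hiff u _).mp (huv.trans hv)
      exact Or.inl (h2.trans h1.symm)
    | ctr f =>
      have h1 : v = f := (hiff v _).mp hv
      have h2 : u = f := (hiff u _).mp (huv.trans hv)
      exact Or.inl (h2.trans h1.symm)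
    | leaf e => exact Or.inr ⟨e, huv.trans hv⟩
  · exact fun i k => ⟨g i k, (hiff _ (.gold i k)).mpr rfl⟩
  · exact fun f => ⟨f, (hiff _ (.ctr f)).mpr rfl⟩
  · intro u v i k k' hu hv hkk'
    have h1 : u = g i k := (hiff u _).mp hu
    have h2 : v = g i k' := (hiff v _).mp hv
    rw [h1, h2]
    exact hgmono i hkk'
  · have hcol : ∀ (κ κ' : Kind (Fin l) F), κ.collapse = κ' →
        (∃ i k, κ = .gold i k ∧ κ' = .gold i 0) ∨ (κ = κ' ∧ ∀ i k, κ' ≠ .gold i k) := by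
      rintro (⟨i, k⟩ | f | e) κ' rfl <;> simp [Kind.collapse]
    rintro (⟨i, k⟩ | f | e)
    · by_cases hk : k = 0
      · subst hk
        convert hgconv i using 1
        ext v
        constructor
        · intro hv
          rcases hcol _ _ hv with ⟨i', k, h1, h2⟩ | ⟨-, h2⟩
          · cases h2
            exact ⟨k, ((hiff v _).mp h1).symm⟩
          · exact absurd rfl (h2 i 0)
        · rintro ⟨k, rfl⟩
          have : kind (g i k) = .gold i k := (hiff _ _).mpr rfl
          simp only [Set.mem_ofPred_eq, this, Kind.collapse]
      -- `collapse` only yields golden kinds of slot `0`, so this class is empty.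
      · convert Set.ordConnected_empty using 1
        refine Set.eq_empty_iff_forall_notMem.mpr fun v hv => ?_
        rcases hcol _ _ hv with ⟨i', k, h1, h2⟩ | ⟨-, h2⟩
        · cases h2
          exact hk rfl
        · exact h2 i k rfl
    · convert Set.ordConnected_singleton (a := (f : V)) using 1
      ext v
      constructor
      · intro hv
        rcases hcol _ _ hv with ⟨i', k, h1, h2⟩ | ⟨h1, -⟩
        · cases h2
        · exact (hiff v _).mp h1
      · intro hv
        have : kind v = .ctr f := (hiff _ _).mpr hv
        simp only [Set.mem_ofPred_eq, this, Kind.collapse]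
    · have hset : {v | (kind v).collapse = .leaf e} = leaves e := by
        ext v
        constructor
        · intro hv
          rcases hcol _ _ hv with ⟨i', k, h1, h2⟩ | ⟨h1, -⟩
          · cases h2
          · exact (hiff v _).mp h1
        · intro hv
          have : kind v = .leaf e := (hiff _ _).mpr hv
          simp only [Set.mem_ofPred_eq, this, Kind.collapse]
      rw [hset]
      rcases e with ⟨i, b⟩ | f
      · exact hΛconv i b
      · by_cases hf : ∃ j, (c j : V) = f
        · obtain ⟨j, hj⟩ := hf
          convert hLconv j using 1
          ext v
          constructor
          · rintro ⟨j', hj', hv⟩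
            rwa [hcinj j' j (hj'.trans hj.symm)] at hv
          · exact fun hv => ⟨j, hj, hv⟩
        · convert Set.ordConnected_empty using 1
          refine Set.eq_empty_iff_forall_notMem.mpr ?_
          rintro v ⟨j, hj, -⟩
          exact hf ⟨j, hj⟩
  · intro x y hyx
    constructor
    · intro hadj
      rcases hback x y ⟨hadj, hyx⟩ with ⟨i, hx, hy⟩ | ⟨hx, hy⟩
      · exact ((harc i x hx y hy hyx).mp hadj).imp (hlink i x y) (hlink i y x)
      · obtain ⟨j, hxj, hyj⟩ := hbackX x hx y hy hyx hadj
        exact ((hstar j x hxj y hyj hyx).mp hadj).imp (fun h => hMarc j x y h.1 h.2)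
          fun h => hMarc j y x h.1 h.2
    · rintro (h | h)
      · rcases hunlink x y h with ⟨i, hx, hy, h⟩ | ⟨j, hx, hy⟩
        · exact (harc i x hx y hy hyx).mpr (Or.inl h)
        · exact (hstar j x (Or.inl hx) y (Or.inr hy) hyx).mpr (Or.inl ⟨hx, hy⟩)
      · rcases hunlink y x h with ⟨i, hy, hx, h⟩ | ⟨j, hy, hx⟩
        · exact (harc i x hx y hy hyx).mpr (Or.inr h)
        · exact (hstar j x (Or.inr hx) y (Or.inl hy) hyx).mpr (Or.inr ⟨hy, hx⟩)

end Translation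

end Tournament

theorem theorem3p3 {V : Type u} [Finite V] (H : Tournament V) (hH : H.IsSpiralGalaxy) :
    Tournament.HasStrongEHProperty.{u, v} H := by
  obtain ⟨_, hH⟩ := hH
  obtain ⟨l, F, kind, hkind⟩ := hH.exists_isSpiralKind
  exact hkind.hasStrongEHProperty
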